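/- **Asymptotic series for $\sum k^\alpha$.** For a field element $x$ and an integer $n\ge 0$ let $\binom{x}{n}=x(x-1)\cdots(x-n+1)/n!$, and let $B_j$ be the Bernoulli numbers, with $B_1=-\tfrac12$. Define rational functions $A_k^{(w)}\in\mathbb Q(w)$, $k\ge 0$, by $$A_0^{(w)}=1,\qquad \sum_{j=0}^{k}\binom{w-j}{2k+1-2j}A_j^{(w)}=0\quad(k>0).$$ Then each $A_k^{(w)}$ is a polynomial in $w$ (so that its value is defined at every complex $w$), and, as an identity in $\mathbb Q(w)$, $$A_k^{(w)}=\sum_{l=0}^{2k}\frac{w}{w+l/2}\binom{w+l/2}{l}\left(\binom{2w}{2k-l}B_{2k-l}-\frac12\sum_{j=1}^{2k-l-1}\binom{2w}{j}\frac{j}{2k-l-j}\binom{k-l/2-j-1}{2k-l-j-1}B_j\right).$$ Let $\alpha$ be a complex number, $\alpha\ne-1$, and write $u=n(n+1)$. As $n\to\infty$ through the positive integers, $$\sum_{k=1}^n k^\alpha-\zeta(-\alpha)\;\sim\;\frac1{\alpha+1}\sum_{k\ge0}A_k^{((\alpha+1)/2)}\,u^{(\alpha+1)/2-k}$$ is an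 asymptotic series, that is, for every integer $p\ge0$, $$\sum_{k=1}^n k^\alpha-\zeta(-\alpha)=\frac1{\alpha+1}\sum_{k=0}^{p}A_k^{((\alpha+1)/2)}\,u^{(\alpha+1)/2-k}+O\!\left(u^{(\alpha+1)/2-p-1}\right).$$ If $\alpha$ is a positive odd integer, the series on the right is finite: only finitely many of the coefficients $A_k^{((\alpha+1)/2)}$ are nonzero. The series on the right converges for all sufficiently large $n$ if and only if $\alpha$ is a nonnegative integer. -/

import Mathlib

open Filter Topology Asymptotics

/-- The generalized binomial coefficient `x (x - 1) ⋯ (x - n + 1) / n!`. -/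
def genBinom {K : Type*} [Field K] (x : K) (n : ℕ) : K :=
  (∏ i ∈ Finset.range n, (x - (i : K))) / (n.factorial : K)

/-- The Faulhaber coefficients `A_k^{(w)}`, as rational functions of an indeterminate
`w = RatFunc.X`: `A_0 = 1`, and for `k > 0` the coefficient `A_k` is obtained by solving
`∑_{j=0}^{k} binom (w - j) (2k + 1 - 2j) * A_j = 0` for `A_k`
(the coefficient of `A_k` is `binom (w - k) 1 = w - k`; see `faulhaberRat_rec`). -/
noncomputable def faulhaberRat : ℕ → RatFunc ℚ
  | 0 => 1
  | k + 1 =>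
      -(∑ j : Fin (k + 1),
          genBinom (RatFunc.X - ((j : ℕ) : RatFunc ℚ)) (2 * (k + 1) + 1 - 2 * (j : ℕ)) *
            faulhaberRat (j : ℕ)) /
        (RatFunc.X - ((k + 1 : ℕ) : RatFunc ℚ))
  termination_by k => k
  decreasing_by exact j.isLt

theorem ratFunc_X_sub_natCast_ne_zero (k : ℕ) : (RatFunc.X - (k : RatFunc ℚ)) ≠ 0 := by
  have h : (RatFunc.X - (k : RatFunc ℚ)) =
      algebraMap (Polynomial ℚ) (RatFunc ℚ) (Polynomial.X - Polynomial.C (k : ℚ)) := by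
    simp
  rw [h]
  exact RatFunc.algebraMap_ne_zero (Polynomial.X_sub_C_ne_zero _)

/-- The defining recurrence of the Faulhaber coefficients. -/
theorem faulhaberRat_rec :
    faulhaberRat 0 = 1 ∧
      ∀ k : ℕ, 0 < k →
        ∑ j ∈ Finset.range (k + 1),
          genBinom (RatFunc.X - (j : RatFunc ℚ)) (2 * k + 1 - 2 * j) * faulhaberRat j = 0 := by
  refine ⟨by rw [faulhaberRat], ?_⟩
  intro k hk
  obtain ⟨k, rfl⟩ : ∃ m, k = m + 1 := ⟨k - 1, by omega⟩
  have hne := ratFunc_X_sub_natCast_ne_zero (k + 1)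
  rw [Finset.sum_range_succ, Finset.sum_range, faulhaberRat]
  have h1 : 2 * (k + 1) + 1 - 2 * (k + 1) = 1 := by omega
  rw [h1]
  have h2 : genBinom (RatFunc.X - ((k + 1 : ℕ) : RatFunc ℚ)) 1 =
      RatFunc.X - ((k + 1 : ℕ) : RatFunc ℚ) := by
    simp [genBinom]
  rw [h2, mul_div_cancel₀ _ hne, add_neg_cancel]

/-- The value `A_k^{(w)}` at a complex number `w`. `RatFunc.eval` evaluates the fraction in lowest
terms, so removable singularities of the recurrence are removed. -/
noncomputable def faulhaberCoeff (k : ℕ) (w : ℂ) : ℂ :=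
  (faulhaberRat k).eval (algebraMap ℚ ℂ) w

/-- The explicit expression for `A_k^{(w)}` in terms of Bernoulli numbers (with `B_1 = -1/2`),
as a rational function of `w = RatFunc.X`. -/
noncomputable def faulhaberExplicit (k : ℕ) : RatFunc ℚ :=
  ∑ l ∈ Finset.range (2 * k + 1),
    RatFunc.X / (RatFunc.X + (l : RatFunc ℚ) / 2) *
      genBinom (RatFunc.X + (l : RatFunc ℚ) / 2) l *
      (genBinom (2 * RatFunc.X) (2 * k - l) * RatFunc.C (bernoulli (2 * k - l)) -
        1 / 2 * ∑ j ∈ Finset.Ico 1 (2 * k - l),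
          genBinom (2 * RatFunc.X) j *
            RatFunc.C ((j : ℚ) / ((2 * k - l - j : ℕ) : ℚ) *
              genBinom ((k : ℚ) - (l : ℚ) / 2 - (j : ℚ) - 1) (2 * k - l - j - 1) *
              bernoulli j))

/-- `u = n (n + 1)`, as a complex number. -/
def faulhaberU (n : ℕ) : ℂ := (n : ℂ) * ((n : ℂ) + 1)

/-- The `k`-th term `(α + 1)⁻¹ A_k^{((α + 1)/2)} u^{(α + 1)/2 - k}` of the series,
where `u = n (n + 1)`. -/
noncomputable def faulhaberTerm (α : ℂ) (n k : ℕ) : ℂ :=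
  1 / (α + 1) * (faulhaberCoeff k ((α + 1) / 2) * faulhaberU n ^ ((α + 1) / 2 - (k : ℂ)))

/-! ### Generalized binomial coefficients and the Rothe–Hagen convolution -/

section Algebra

open scoped Polynomial

variable {K : Type*} [Field K]

/-! For natural `w` the Bernoulli polynomial `B_{2w}(x)` is invariant under `x ↦ 1 - x`, hence a
polynomial in `x² - x`, which is `u` at `x = n + 1`. Its coefficient at `(x² - x)^(w - k)`, for `k ≤
w`, is the value at `w` of a polynomial `faulhaberPoly k` not depending on `w`
(`coeff_bernoulliFolded`). Comparing powers of `x` gives `(-1)^i B_i binom(2w, i) = ∑_j A_j(w)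
binom(w - j, i - 2j)`, first for natural `w ≥ i`, then as a polynomial identity
(`bernoulli_convolution`). Everything rests on it.

Odd `i ≥ 3` kills the left side and leaves the defining recurrence, so `A_k` is `faulhaberPoly k`;
the Rothe–Hagen convolution turns this polynomial into the explicit formula.

For even `i` the left side grows factorially unless `2w` is a natural number, so the `A_k` outgrow
every geometric sequence. If `2w` is natural, only boundedly many Bernoulli numbers enter and the
growth is geometric. This decides convergence.

For the asymptotics, put `α = 2w - 1`. By the same identity the truncated series telescopes against
`2w ∑ k^(2w-1)` up to a small error, uniformly for bounded `w`
(`exists_norm_faulhaberError_succ_sub_le`). The difference thus has a limit analytic in `w`; for `Re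
w < 0` it is `2w ζ(1 - 2w)`, and the identity theorem gives it elsewhere (`tendsto_faulhaberError`).
Summing the tail of the increments gives the rate. -/

theorem genBinom_zero (x : K) : genBinom x 0 = 1 := by simp [genBinom]

theorem genBinom_one (x : K) : genBinom x 1 = x := by simp [genBinom]

theorem genBinom_succ (x : K) (n : ℕ) :
    genBinom x (n + 1) = genBinom x n * (x - n) / (n + 1) := by
  simp only [genBinom, Finset.prod_range_succ, Nat.factorial_succ, Nat.cast_mul, Nat.cast_add,
    Nat.cast_one]
  rw [div_mul_eq_mul_div, div_div, mul_comm ((n : K) + 1)]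

theorem genBinom_succ' (x : K) (n : ℕ) :
    genBinom x (n + 1) = x * genBinom (x - 1) n / (n + 1) := by
  simp only [genBinom, Finset.prod_range_succ', Nat.factorial_succ, Nat.cast_mul, Nat.cast_add,
    Nat.cast_one, Nat.cast_zero, sub_zero, sub_sub, add_comm (1 : K)]
  rw [mul_div_assoc', div_div, mul_comm x, mul_comm ((n : K) + 1)]

theorem genBinom_natCast [CharZero K] (n k : ℕ) : genBinom (n : K) k = (n.choose k : K) := by
  induction k with
  | zero => simp [genBinom_zero]
  | succ k ih =>
    have hk : (k : K) + 1 ≠ 0 := by exact_mod_cast k.succ_ne_zero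
    rw [genBinom_succ, ih, div_eq_iff hk]
    rcases le_or_gt k n with h | h
    · rw [← Nat.cast_sub h]
      exact_mod_cast (Nat.choose_succ_right_eq n k).symm
    · simp [Nat.choose_eq_zero_of_lt h, Nat.choose_eq_zero_of_lt (h.trans k.lt_succ_self)]

/-- The coefficients `(a / (a + m)) * binom ((a + m) / 2) m` of the generalized binomial series
with parameter `1 / 2`, written without removable singularity. -/
def hagenCoeff (a : K) : ℕ → K
  | 0 => 1
  | m + 1 => a / 2 * genBinom ((a + (m + 1)) / 2 - 1) m / (m + 1)

theorem hagenCoeff_zero_succ (m : ℕ) : hagenCoeff (0 : K) (m + 1) = 0 := by simp [hagenCoeff]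

/-- With `β = (z + √(z² + 4)) / 2`, `hagenCoeff a m` is the coefficient of `z^m` in `β^a`; the
relation reflects `β² = zβ + 1`. -/
theorem hagenCoeff_pascal [CharZero K] (a : K) (m : ℕ) :
    hagenCoeff (a + 2) (m + 1) = hagenCoeff (a + 1) m + hagenCoeff a (m + 1) := by
  rcases m with _ | m
  · simp only [hagenCoeff, genBinom_zero]
    field_simp
    simp
    ring
  · obtain ⟨y, rfl⟩ : ∃ y, a = 2 * y - m - 2 := ⟨(a + m + 2) / 2, by ring⟩
    have h1 : (m : K) + 1 ≠ 0 := by exact_mod_cast m.succ_ne_zero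
    have h2 : (m : K) + 1 + 1 ≠ 0 := by exact_mod_cast (m + 1).succ_ne_zero
    simp only [hagenCoeff, Nat.cast_add, Nat.cast_one]
    have e1 : (2 * y - m - 2 + 2 + ((m : K) + 1 + 1)) / 2 - 1 = y := by ring
    have e2 : (2 * y - m - 2 + 1 + ((m : K) + 1)) / 2 - 1 = y - 1 := by ring
    have e3 : (2 * y - m - 2 + ((m : K) + 1 + 1)) / 2 - 1 = y - 1 := by ring
    rw [e1, e2, e3, genBinom_succ' y, genBinom_succ (y - 1)]
    field_simp
    ring

theorem Polynomial.eq_of_eval_eq_of_injective {p q : K[X]} (f : ℕ → K) (hf : Function.Injective f)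
    (N : ℕ) (h : ∀ n, N ≤ n → p.eval (f n) = q.eval (f n)) : p = q := by
  refine Polynomial.eq_of_infinite_eval_eq p q ?_
  refine ((Set.Ici_infinite N).image hf.injOn).mono ?_
  rintro _ ⟨n, hn, rfl⟩
  exact h n hn

/-- The polynomial whose values are the generalized binomial coefficients. -/
noncomputable def binomPoly (n : ℕ) : ℚ[X] :=
  Polynomial.C ((n.factorial : ℚ)⁻¹) * ∏ i ∈ Finset.range n, (Polynomial.X - (i : ℚ[X]))

/-- The polynomial whose values are given by `hagenCoeff`. -/
noncomputable def hagenPoly : ℕ → ℚ[X]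
  | 0 => 1
  | m + 1 => Polynomial.C (1 / 2) * Polynomial.X *
      (binomPoly m).comp (Polynomial.C (1 / 2) * (Polynomial.X + ((m : ℚ[X]) + 1)) - 1) *
      Polynomial.C ((m + 1 : ℚ)⁻¹)

/-- The Faulhaber coefficients as polynomials. -/
noncomputable def faulhaberPoly (k : ℕ) : ℚ[X] :=
  ∑ j ∈ Finset.range (2 * k + 1), Polynomial.C (bernoulli j) *
    ((binomPoly j).comp (2 * Polynomial.X) *
      (hagenPoly (2 * k - j)).comp (2 * Polynomial.X - (j : ℚ[X])))

variable [Algebra ℚ K]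

theorem aeval_binomPoly (x : K) (n : ℕ) : Polynomial.aeval x (binomPoly n) = genBinom x n := by
  simp [binomPoly, genBinom, div_eq_inv_mul]

theorem aeval_hagenPoly (a : K) (m : ℕ) : Polynomial.aeval a (hagenPoly m) = hagenCoeff a m := by
  rcases m with _ | m
  · simp [hagenPoly, hagenCoeff]
  · simp only [hagenPoly, hagenCoeff, map_mul, Polynomial.aeval_comp, Polynomial.aeval_C,
      Polynomial.aeval_X, map_sub, map_add, map_one, map_natCast, aeval_binomPoly, map_inv₀,
      map_div₀, map_ofNat]
    rw [div_eq_mul_inv _ ((m : K) + 1), show 1 / 2 * (a + ((m : K) + 1)) = (a + (m + 1)) / 2 by ring]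
    ring

theorem aeval_faulhaberPoly (w : K) (k : ℕ) : Polynomial.aeval w (faulhaberPoly k) =
    ∑ j ∈ Finset.range (2 * k + 1), algebraMap ℚ K (bernoulli j) *
      (genBinom (2 * w) j * hagenCoeff (2 * w - j) (2 * k - j)) := by
  simp [faulhaberPoly, map_ofNat, aeval_binomPoly, aeval_hagenPoly, Polynomial.aeval_comp]

/-- The Rothe–Hagen convolution identity with parameter `1 / 2`. -/
theorem sum_antidiagonal_hagenCoeff [CharZero K] (a b : K) (n : ℕ) :
    ∑ x ∈ Finset.HasAntidiagonal.antidiagonal n, hagenCoeff a x.1 * hagenCoeff b x.2 = hagenCoeff (a + b) n := by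
  induction n generalizing a with
  | zero => simp [hagenCoeff]
  | succ n ih =>
    let p : K[X] := ∑ x ∈ Finset.HasAntidiagonal.antidiagonal (n + 1),
      (hagenPoly x.1).map (algebraMap ℚ K) * Polynomial.C (hagenCoeff b x.2)
    let q : K[X] := ((hagenPoly (n + 1)).map (algebraMap ℚ K)).comp
      (Polynomial.X + Polynomial.C b)
    have hp (x : K) : p.eval x = ∑ y ∈ Finset.HasAntidiagonal.antidiagonal (n + 1),
        hagenCoeff x y.1 * hagenCoeff b y.2 := by
      simp [p, Polynomial.eval_finsetSum, aeval_hagenPoly, Polynomial.eval_map_algebraMap]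
    have hq (x : K) : q.eval x = hagenCoeff (x + b) (n + 1) := by
      simp [q, aeval_hagenPoly, Polynomial.eval_map_algebraMap]
    suffices p = q by rw [← hp, ← hq, this]
    -- Both sides are polynomials in `a`. The Pascal rule shifts `a` by 2, so they are compared at
    -- even naturals, the leftover term at `2r + 1` being covered by the induction on `n`.
    refine Polynomial.eq_of_eval_eq_of_injective (fun r : ℕ => 2 * (r : K))
      (fun r s h => by simpa using h) 0 fun r hr => ?_
    clear hr
    rw [hp, hq]
    induction r with
    | zero =>
      rw [Finset.Nat.sum_antidiagonal_succ]
      simp [hagenCoeff_zero_succ, show hagenCoeff (0 : K) 0 = 1 from rfl]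
    | succ r ihr =>
      rw [Finset.Nat.sum_antidiagonal_succ] at ihr ⊢
      have e : 2 * ((r + 1 : ℕ) : K) = 2 * r + 2 := by push_cast; ring
      simp only [e, hagenCoeff_pascal, add_mul, Finset.sum_add_distrib, ih]
      rw [show 2 * (r : K) + 2 + b = 2 * r + b + 2 by ring, hagenCoeff_pascal, ← ihr,
        show 2 * (r : K) + 1 + b = 2 * r + b + 1 by ring]
      simp only [hagenCoeff]
      ring

/-- Splits the parameter `2w - j` as `2w + (-j)` by Rothe–Hagen, then exchanges the sums. -/
theorem aeval_faulhaberPoly_eq_convolution [CharZero K] (w : K) (k : ℕ) :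
    Polynomial.aeval w (faulhaberPoly k) =
      ∑ l ∈ Finset.range (2 * k + 1), hagenCoeff (2 * w) l *
        ∑ j ∈ Finset.range (2 * k - l + 1),
          genBinom (2 * w) j * algebraMap ℚ K (bernoulli j) *
            hagenCoeff (-(j : K)) (2 * k - l - j) := by
  simp only [Finset.mul_sum]
  rw [Finset.sum_comm' (t' := Finset.range (2 * k + 1))
    (s' := fun j => Finset.range (2 * k - j + 1))
    (by intro x y; simp only [Finset.mem_range]; omega), aeval_faulhaberPoly]
  refine Finset.sum_congr rfl fun j _ => ?_
  rw [sub_eq_add_neg, ← sum_antidiagonal_hagenCoeff, Finset.Nat.sum_antidiagonal_eq_sum_range_succ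
    (fun x y => hagenCoeff (2 * w) x * hagenCoeff (-(j : K)) y), Finset.mul_sum, Finset.mul_sum]
  refine Finset.sum_congr rfl fun l _ => ?_
  rw [Nat.sub_right_comm]
  ring

end Algebra

/-! ### The explicit Bernoulli-number formula -/

section Explicit

open scoped Polynomial

theorem ratFunc_X_add_div_two_ne_zero (l : ℕ) : (RatFunc.X + (l : RatFunc ℚ) / 2) ≠ 0 := by
  have h : (RatFunc.X + (l : RatFunc ℚ) / 2) =
      algebraMap (Polynomial ℚ) (RatFunc ℚ) (Polynomial.X + Polynomial.C ((l : ℚ) / 2)) := by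
    simp
  rw [h]
  exact RatFunc.algebraMap_ne_zero (Polynomial.X_add_C_ne_zero _)

theorem ratFunc_hagenCoeff (l : ℕ) :
    RatFunc.X / (RatFunc.X + (l : RatFunc ℚ) / 2) * genBinom (RatFunc.X + (l : RatFunc ℚ) / 2) l =
      hagenCoeff (2 * RatFunc.X) l := by
  rcases l with _ | l
  · simp [hagenCoeff, genBinom_zero, RatFunc.X_ne_zero]
  · have h := ratFunc_X_add_div_two_ne_zero (l + 1)
    rw [genBinom_succ', hagenCoeff]
    rw [show (2 * RatFunc.X + ((l : RatFunc ℚ) + 1)) / 2 - 1 =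
      RatFunc.X + ((l + 1 : ℕ) : RatFunc ℚ) / 2 - 1 by push_cast; ring]
    generalize RatFunc.X + ((l + 1 : ℕ) : RatFunc ℚ) / 2 = y at h ⊢
    field_simp

theorem map_genBinom {K L : Type*} [Field K] [Field L] (f : K →+* L) (x : K) (n : ℕ) :
    f (genBinom x n) = genBinom (f x) n := by
  simp [genBinom]

/-- When `2k - l > 0`, the term `j = 0` on the right vanishes because `hagenCoeff 0` is zero in
positive degree. The top term `j = 2k - l` carries `hagenCoeff _ 0 = 1`, and the factor `-j/2` in
the remaining ones produces `-1/2`. -/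
theorem faulhaberExplicit_inner (k l : ℕ) (hl : l ≤ 2 * k) :
    genBinom (2 * RatFunc.X) (2 * k - l) * RatFunc.C (bernoulli (2 * k - l)) -
        1 / 2 * ∑ j ∈ Finset.Ico 1 (2 * k - l),
          genBinom (2 * RatFunc.X) j *
            RatFunc.C ((j : ℚ) / ((2 * k - l - j : ℕ) : ℚ) *
              genBinom ((k : ℚ) - (l : ℚ) / 2 - (j : ℚ) - 1) (2 * k - l - j - 1) *
              bernoulli j) =
      ∑ j ∈ Finset.range (2 * k - l + 1),
          genBinom (2 * RatFunc.X) j * algebraMap ℚ (RatFunc ℚ) (bernoulli j) *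
            hagenCoeff (-(j : RatFunc ℚ)) (2 * k - l - j) := by
  obtain ⟨n, hn⟩ : ∃ n, n = 2 * k - l := ⟨_, rfl⟩
  have hk : (k : ℚ) = (n + l) / 2 := by
    have : (n : ℚ) + l = 2 * k := by exact_mod_cast (by omega : n + l = 2 * k)
    rw [this]; ring
  rw [← hn, hk, Finset.sum_range_succ]
  simp only [show algebraMap ℚ (RatFunc ℚ) = RatFunc.C from Subsingleton.elim _ _]
  rcases Nat.eq_zero_or_pos n with rfl | hpos
  · simp [hagenCoeff]
  · rw [Finset.range_eq_Ico, Finset.sum_eq_sum_Ico_succ_bot hpos]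
    obtain ⟨m, hm⟩ : ∃ m, n - 0 = m + 1 := ⟨n - 1, by omega⟩
    rw [hm, Nat.cast_zero, neg_zero, hagenCoeff_zero_succ, Nat.sub_self, mul_zero, zero_add,
      zero_add, sub_eq_neg_add, Finset.mul_sum, ← Finset.sum_neg_distrib]
    congr 1
    · refine Finset.sum_congr rfl fun j hj => ?_
      rw [Finset.mem_Ico] at hj
      obtain ⟨r, rfl⟩ : ∃ r, n = j + r + 1 := ⟨n - j - 1, by omega⟩
      have e : j + r + 1 - j = r + 1 := by omega
      rw [e, hagenCoeff, Nat.add_sub_cancel]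
      simp only [map_mul, map_div₀, map_genBinom, map_sub, map_natCast, map_add, map_one,
        map_ofNat]
      rw [show (((j + r + 1 : ℕ) : RatFunc ℚ) + l) / 2 - (l : RatFunc ℚ) / 2 - j - 1 =
        (-(j : RatFunc ℚ) + (r + 1)) / 2 - 1 by push_cast; ring]
      push_cast
      ring
    · simp [hagenCoeff]

theorem faulhaberExplicit_eq (k : ℕ) :
    faulhaberExplicit k = algebraMap ℚ[X] (RatFunc ℚ) (faulhaberPoly k) := by
  have h : algebraMap ℚ[X] (RatFunc ℚ) (faulhaberPoly k) =
      Polynomial.aeval (RatFunc.X : RatFunc ℚ) (faulhaberPoly k) := by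
    rw [← RatFunc.algebraMap_X, Polynomial.aeval_algebraMap_apply, Polynomial.aeval_X_left_apply]
  rw [h, aeval_faulhaberPoly_eq_convolution, faulhaberExplicit]
  refine Finset.sum_congr rfl fun l hl => ?_
  rw [ratFunc_hagenCoeff, faulhaberExplicit_inner k l (by simpa [Nat.lt_succ_iff] using hl)]

end Explicit

/-! ### Folding Bernoulli polynomials into powers of `x² - x` -/

section Lucas

open scoped Polynomial

/-- The polynomials `L_a` in `u` with `x ^ a + (1 - x) ^ a = L_a (x ^ 2 - x)`. -/
noncomputable def lucasPoly : ℕ → ℚ[X]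
  | 0 => 2
  | 1 => 1
  | a + 2 => lucasPoly (a + 1) + Polynomial.X * lucasPoly a

/-- Both `x` and `1 - x` are roots of `t² = t + (x² - x)`, so their power sums obey the recursion.
-/
theorem lucasPoly_comp (a : ℕ) : (lucasPoly a).comp (Polynomial.X ^ 2 - Polynomial.X) =
    Polynomial.X ^ a + (1 - Polynomial.X) ^ a := by
  induction a using Nat.twoStepInduction with
  | zero => simp [lucasPoly]; norm_num
  | one => simp [lucasPoly]
  | more a h0 h1 =>
    rw [lucasPoly, Polynomial.add_comp, Polynomial.mul_comp, h0, h1, Polynomial.X_comp]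
    ring

theorem coeff_lucasPoly (a i : ℕ) : (lucasPoly a).coeff i =
    if 2 * i ≤ a then 2 * hagenCoeff (a : ℚ) (a - 2 * i) else 0 := by
  induction a using Nat.twoStepInduction generalizing i with
  | zero =>
    rw [lucasPoly, ← Polynomial.C_ofNat, Polynomial.coeff_C]
    rcases i with _ | i <;> simp [hagenCoeff]
  | one =>
    rw [lucasPoly, Polynomial.coeff_one]
    rcases i with _ | i
    · simp [hagenCoeff, genBinom_zero]
    · simp [show ¬ 2 * (i + 1) ≤ 1 by omega]
  | more a h0 h1 =>
    rw [lucasPoly, Polynomial.coeff_add, h1]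
    have pascal (m : ℕ) := hagenCoeff_pascal (a : ℚ) m
    push_cast
    rcases i with _ | i
    -- The constant term receives nothing from `X * lucasPoly a`; the matching Pascal term contains
    -- `binom(a, a + 1) = 0`.
    · have h : hagenCoeff (a : ℚ) (a + 2) = 0 := by
        rw [hagenCoeff, show ((a : ℚ) + (((a + 1 : ℕ) : ℚ) + 1)) / 2 - 1 = (a : ℕ) by
          push_cast; ring, genBinom_natCast, Nat.choose_succ_self]
        simp
      simp [pascal, h]
    · rw [Polynomial.coeff_X_mul, h0]
      by_cases hi : 2 * i ≤ a
      · rw [if_pos hi, if_pos (by omega : 2 * (i + 1) ≤ a + 2)]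
        rw [show a + 2 - 2 * (i + 1) = a - 2 * i by omega]
        rcases Nat.eq_zero_or_pos (a - 2 * i) with h | h
        · rw [if_neg (by omega), h]
          simp [hagenCoeff]
        · obtain ⟨m, hm⟩ : ∃ m, a - 2 * i = m + 1 := ⟨a - 2 * i - 1, by omega⟩
          rw [if_pos (by omega), hm, pascal, show a + 1 - 2 * (i + 1) = m by omega]
          ring
      · rw [if_neg hi, if_neg (by omega), if_neg (by omega), add_zero]

/-- The even Bernoulli polynomial `B_{2w}` as a polynomial in `x ^ 2 - x`. -/
noncomputable def bernoulliFolded (w : ℕ) : ℚ[X] :=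
  ∑ j ∈ Finset.range (2 * w + 1),
    Polynomial.C (bernoulli j * (2 * w).choose j / 2) * lucasPoly (2 * w - j)

/-- By the symmetry `B_{2w}(1 - x) = B_{2w}(x)`, the polynomial equals its average over `x` and `1 -
x`, which turns each `x^a` into half a Lucas polynomial. -/
theorem bernoulliFolded_comp (w : ℕ) :
    (bernoulliFolded w).comp (Polynomial.X ^ 2 - Polynomial.X) = Polynomial.bernoulli (2 * w) := by
  have h1 : Polynomial.bernoulli (2 * w) = ∑ j ∈ Finset.range (2 * w + 1),
      Polynomial.C (bernoulli j * (2 * w).choose j) * Polynomial.X ^ (2 * w - j) := by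
    simp only [Polynomial.bernoulli, Polynomial.C_mul_X_pow_eq_monomial]
  have h2 : (Polynomial.bernoulli (2 * w)).comp (1 - Polynomial.X) =
      Polynomial.bernoulli (2 * w) := by
    rw [Polynomial.bernoulli_comp_one_sub_X]; simp
  have h3 : Polynomial.bernoulli (2 * w) = Polynomial.C (1 / 2) *
      (Polynomial.bernoulli (2 * w) + (Polynomial.bernoulli (2 * w)).comp (1 - Polynomial.X)) := by
    rw [h2, ← two_mul, ← mul_assoc, ← Polynomial.C_ofNat, ← Polynomial.C_mul]
    norm_num
  rw [h3, h1, bernoulliFolded]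
  simp only [Polynomial.sum_comp, Polynomial.mul_comp, Polynomial.C_comp, lucasPoly_comp,
    Polynomial.pow_comp, Polynomial.X_comp, ← Finset.sum_add_distrib, Finset.mul_sum, ← mul_add,
    ← mul_assoc, ← Polynomial.C_mul]
  refine Finset.sum_congr rfl fun j _ => ?_
  ring_nf

theorem coeff_bernoulliFolded (w k : ℕ) (hk : k ≤ w) :
    (bernoulliFolded w).coeff (w - k) = (faulhaberPoly k).eval (w : ℚ) := by
  have h := aeval_faulhaberPoly (w : ℚ) k
  rw [Polynomial.coe_aeval_eq_eval] at h
  rw [h, bernoulliFolded, Polynomial.finsetSum_coeff]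
  have hsub : Finset.range (2 * k + 1) ⊆ Finset.range (2 * w + 1) :=
    Finset.range_subset_range.2 (by omega)
  rw [← Finset.sum_subset hsub]
  · refine Finset.sum_congr rfl fun j hj => ?_
    have hj : j ≤ 2 * k := by simpa [Nat.lt_succ_iff] using hj
    rw [Polynomial.coeff_C_mul, coeff_lucasPoly, if_pos (by omega),
      show 2 * w - j - 2 * (w - k) = 2 * k - j by omega,
      show 2 * (w : ℚ) = ((2 * w : ℕ) : ℚ) by push_cast; ring, genBinom_natCast,
      ← Nat.cast_sub (by omega : j ≤ 2 * w)]
    simp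
    ring
  · intro j hj hj'
    simp only [Finset.mem_range, not_lt] at hj hj'
    rw [Polynomial.coeff_C_mul, coeff_lucasPoly, if_neg (by omega), mul_zero]

theorem natDegree_bernoulliFolded_le (w : ℕ) : (bernoulliFolded w).natDegree ≤ w := by
  refine Polynomial.natDegree_le_iff_coeff_eq_zero.2 fun r hr => ?_
  rw [bernoulliFolded, Polynomial.finsetSum_coeff]
  refine Finset.sum_eq_zero fun j _ => ?_
  rw [Polynomial.coeff_C_mul, coeff_lucasPoly, if_neg (by omega), mul_zero]

theorem coeff_X_sq_sub_X_pow (r s : ℕ) (hs : s ≤ 2 * r) :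
    ((Polynomial.X ^ 2 - Polynomial.X : ℚ[X]) ^ r).coeff (2 * r - s) = (-1) ^ s * r.choose s := by
  rw [show (Polynomial.X ^ 2 - Polynomial.X : ℚ[X]) =
    (Polynomial.X + Polynomial.C (-1)) * Polynomial.X by simp; ring, mul_pow]
  rcases le_or_gt s r with h | h
  · rw [show 2 * r - s = (r - s) + r by omega, Polynomial.coeff_mul_X_pow,
      Polynomial.coeff_X_add_C_pow, Nat.choose_symm h, Nat.sub_sub_self h]
  · rw [Polynomial.coeff_mul_X_pow', if_neg (by omega), Nat.choose_eq_zero_of_lt h]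
    simp

/-- Compares coefficients of `x^(2w - i)` in `B_{2w}(x) = ∑_j A_j(w) (x² - x)^(w - j)`. Terms with
`2j > i` have too small a degree to contribute. -/
theorem bernoulli_convolution_natCast (w i : ℕ) (hi : i ≤ w) :
    (-1) ^ i * (bernoulli i * genBinom (2 * w : ℚ) i) =
      ∑ j ∈ Finset.range (i / 2 + 1),
        (faulhaberPoly j).eval (w : ℚ) * genBinom ((w : ℚ) - j) (i - 2 * j) := by
  have h := congrArg (fun p => p.coeff (2 * w - i)) (bernoulliFolded_comp w)
  simp only [Polynomial.coeff_bernoulli] at h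
  rw [if_pos (by omega), Nat.sub_sub_self (by omega), Nat.choose_symm (by omega),
    Polynomial.comp, Polynomial.eval₂_eq_sum_range' _
      (Nat.lt_succ_of_le (natDegree_bernoulliFolded_le w)), Polynomial.finsetSum_coeff,
    ← Finset.sum_range_reflect] at h
  rw [show (2 * w : ℚ) = ((2 * w : ℕ) : ℚ) by push_cast; ring, genBinom_natCast, ← h,
    Finset.mul_sum]
  have hsub : Finset.range (i / 2 + 1) ⊆ Finset.range (w + 1) :=
    Finset.range_subset_range.2 (by omega)
  symm
  rw [← Finset.sum_subset hsub]
  · refine Finset.sum_congr rfl fun j hj => ?_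
    have hj : j ≤ i / 2 := by simpa [Nat.lt_succ_iff] using hj
    rw [show w + 1 - 1 - j = w - j by omega, Polynomial.coeff_C_mul,
      coeff_bernoulliFolded w j (by omega), show 2 * w - i = 2 * (w - j) - (i - 2 * j) by omega,
      coeff_X_sq_sub_X_pow _ _ (by omega), ← Nat.cast_sub (by omega), genBinom_natCast]
    have : (-1 : ℚ) ^ i = (-1) ^ (i - 2 * j) := by
      conv_lhs => rw [show i = (i - 2 * j) + 2 * j by omega, pow_add, pow_mul]
      simp
    rw [this, mul_left_comm ((-1) ^ (i - 2 * j) : ℚ), ← mul_assoc ((-1) ^ (i - 2 * j) : ℚ) _ _,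
      ← mul_pow]
    simp
  · intro j hj hj'
    simp only [Finset.mem_range, not_lt] at hj hj'
    rw [Polynomial.coeff_C_mul, Polynomial.coeff_eq_zero_of_natDegree_lt (n := 2 * w - i), mul_zero, mul_zero]
    refine lt_of_le_of_lt Polynomial.natDegree_pow_le ?_
    have : (Polynomial.X ^ 2 - Polynomial.X : ℚ[X]).natDegree ≤ 2 := by compute_degree
    calc _ ≤ (w + 1 - 1 - j) * 2 := Nat.mul_le_mul_left _ this
      _ < _ := by omega

theorem bernoulli_convolution_poly (i : ℕ) :
    (-1) ^ i * (Polynomial.C (bernoulli i) * (binomPoly i).comp (2 * Polynomial.X)) =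
      ∑ j ∈ Finset.range (i / 2 + 1),
        faulhaberPoly j * (binomPoly (i - 2 * j)).comp (Polynomial.X - (j : ℚ[X])) := by
  refine Polynomial.eq_of_eval_eq_of_injective (fun r : ℕ => (r : ℚ)) Nat.cast_injective i
    fun w hw => ?_
  have hb (x : ℚ) (n : ℕ) : (binomPoly n).eval x = genBinom x n := by
    rw [← aeval_binomPoly, Polynomial.coe_aeval_eq_eval]
  simpa [Polynomial.eval_finsetSum, hb] using bernoulli_convolution_natCast w i hw

theorem bernoulli_convolution {K : Type*} [Field K] [Algebra ℚ K] (w : K) (i : ℕ) :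
    (-1) ^ i * (algebraMap ℚ K (bernoulli i) * genBinom (2 * w) i) =
      ∑ j ∈ Finset.range (i / 2 + 1),
        Polynomial.aeval w (faulhaberPoly j) * genBinom (w - j) (i - 2 * j) := by
  have h := congrArg (Polynomial.aeval w) (bernoulli_convolution_poly i)
  simpa [Polynomial.aeval_comp, aeval_binomPoly, map_ofNat] using h

/-- Since `B_{2k+1} = 0` for `k > 0`, the convolution at `i = 2k + 1` is the defining recurrence,
which determines `A_k` because `w - k` is invertible in `ℚ(w)`. -/
theorem faulhaberRat_eq (k : ℕ) :
    faulhaberRat k = algebraMap ℚ[X] (RatFunc ℚ) (faulhaberPoly k) := by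
  have hX (p : ℚ[X]) : algebraMap ℚ[X] (RatFunc ℚ) p =
      Polynomial.aeval (RatFunc.X : RatFunc ℚ) p := by
    rw [← RatFunc.algebraMap_X, Polynomial.aeval_algebraMap_apply, Polynomial.aeval_X_left_apply]
  induction k using Nat.strong_induction_on with
  | _ k ih =>
    rcases Nat.eq_zero_or_pos k with rfl | hk
    · rw [faulhaberRat_rec.1, hX, aeval_faulhaberPoly]
      simp [genBinom_zero, hagenCoeff]
    · have h1 := faulhaberRat_rec.2 k hk
      have h2 := bernoulli_convolution (RatFunc.X : RatFunc ℚ) (2 * k + 1)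
      rw [bernoulli_eq_zero_of_odd ⟨k, rfl⟩ (by omega), map_zero, zero_mul, mul_zero,
        show (2 * k + 1) / 2 = k by omega] at h2
      rw [Finset.sum_range_succ] at h1 h2
      rw [show 2 * k + 1 - 2 * k = 1 by omega, genBinom_one] at h1 h2
      have h3 : ∑ j ∈ Finset.range k, genBinom (RatFunc.X - (j : RatFunc ℚ)) (2 * k + 1 - 2 * j) *
          faulhaberRat j = ∑ j ∈ Finset.range k, Polynomial.aeval (RatFunc.X : RatFunc ℚ)
            (faulhaberPoly j) * genBinom (RatFunc.X - (j : RatFunc ℚ)) (2 * k + 1 - 2 * j) :=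
        Finset.sum_congr rfl fun j hj => by
          rw [ih j (Finset.mem_range.1 hj), hX, mul_comm]
      rw [hX]
      refine mul_left_cancel₀ (ratFunc_X_sub_natCast_ne_zero k) ?_
      linear_combination h1 + h2 - h3

theorem faulhaberCoeff_eq (k : ℕ) (w : ℂ) :
    faulhaberCoeff k w = Polynomial.aeval w (faulhaberPoly k) := by
  rw [faulhaberCoeff, faulhaberRat_eq, RatFunc.eval_algebraMap, Polynomial.aeval_def, Algebra.algebraMap_self,
    RingHom.id_apply]

end Lucas

/-! ### Growth of the coefficients -/

section Growth

theorem norm_genBinom_le (x : ℂ) (N n : ℕ) (hx : ‖x‖ ≤ N) : ‖genBinom x n‖ ≤ 2 ^ (N + n) := by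
  suffices ‖genBinom x n‖ ≤ (N + n).choose n by
    refine this.trans ?_
    exact_mod_cast Nat.choose_le_two_pow _ _
  induction n with
  | zero => simp [genBinom_zero]
  | succ n ih =>
    have hn : (0 : ℝ) < n + 1 := by positivity
    have h1 : ‖x - n‖ ≤ N + n + 1 := by
      refine (norm_sub_le _ _).trans ?_
      rw [Complex.norm_natCast]
      linarith
    have h2 : ((N + n + 1 : ℕ) : ℝ) * (N + n).choose n =
        (N + n + 1).choose (n + 1) * (n + 1 : ℕ) := by
      exact_mod_cast Nat.add_one_mul_choose_eq (N + n) n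
    have h3 : ‖((n : ℂ) + 1)‖ = n + 1 := by exact_mod_cast Complex.norm_natCast (n + 1)
    rw [genBinom_succ, norm_div, norm_mul, h3, div_le_iff₀ hn]
    calc ‖genBinom x n‖ * ‖x - n‖ ≤ (N + n).choose n * (N + n + 1) := by gcongr
      _ = _ := by push_cast at h2; rw [mul_comm, h2]; rfl

theorem norm_hagenCoeff_le (a : ℂ) (N m : ℕ) (ha : ‖a‖ ≤ N) :
    ‖hagenCoeff a m‖ ≤ (N + 1) * 2 ^ N * 4 ^ m := by
  have hN : (0 : ℝ) ≤ N := N.cast_nonneg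
  rcases m with _ | m
  · have : (1 : ℝ) ≤ 2 ^ N := one_le_pow₀ (by norm_num)
    simp only [hagenCoeff, norm_one, pow_zero, mul_one]
    nlinarith
  · have hx : ‖(a + (m + 1)) / 2 - 1‖ ≤ (N + m + 2 : ℕ) := by
      have h3 : ‖((m : ℂ) + 1)‖ = m + 1 := by exact_mod_cast Complex.norm_natCast (m + 1)
      rw [show (a + (m + 1)) / 2 - 1 = (a + (m + 1) - 2) / 2 by ring, norm_div, Complex.norm_ofNat,
        div_le_iff₀ (by norm_num)]
      refine (norm_sub_le _ _).trans ?_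
      have := norm_add_le a (m + 1)
      rw [h3] at this
      rw [Complex.norm_ofNat]
      push_cast
      linarith [m.cast_nonneg (α := ℝ)]
    have h := norm_genBinom_le _ _ m hx
    have h3 : 1 ≤ ‖((m : ℂ) + 1)‖ := by
      rw [show ‖((m : ℂ) + 1)‖ = m + 1 by exact_mod_cast Complex.norm_natCast (m + 1)]
      linarith [m.cast_nonneg (α := ℝ)]
    rw [hagenCoeff, norm_div, norm_mul]
    refine (div_le_self (by positivity) h3).trans ?_
    have h2 : ‖a / 2‖ ≤ N + 1 := by
      rw [norm_div, Complex.norm_ofNat]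
      linarith
    calc _ ≤ ((N : ℝ) + 1) * 2 ^ (N + m + 2 + m) := by gcongr
      _ = ((N : ℝ) + 1) * 2 ^ (N + 2 * (m + 1)) := by ring_nf
      _ = _ := by rw [pow_add, pow_mul]; norm_num; ring

theorem faulhaberCoeff_eq_sum (k : ℕ) (w : ℂ) : faulhaberCoeff k w =
    ∑ j ∈ Finset.range (2 * k + 1), (bernoulli j : ℂ) *
      (genBinom (2 * w) j * hagenCoeff (2 * w - j) (2 * k - j)) := by
  rw [faulhaberCoeff_eq, aeval_faulhaberPoly]
  rfl

/-- For `j > 2w` the factor `binom(2w, j)` vanishes. Otherwise `hagenCoeff` contains `binom(w + k -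
j - 1, 2k - j - 1)`, whose upper index is a natural number below the lower one. -/
theorem faulhaberCoeff_natCast_eq_zero (k w : ℕ) (hk : w < k) : faulhaberCoeff k (w : ℂ) = 0 := by
  rw [faulhaberCoeff_eq_sum]
  refine Finset.sum_eq_zero fun j _ => ?_
  have h2w : 2 * (w : ℂ) = ((2 * w : ℕ) : ℂ) := by push_cast; ring
  rcases lt_or_ge (2 * w) j with h | h
  · rw [h2w, genBinom_natCast, Nat.choose_eq_zero_of_lt h]
    simp
  · obtain ⟨s, hs⟩ : ∃ s, 2 * k - j = s + 1 := ⟨2 * k - j - 1, by omega⟩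
    obtain ⟨r, hr⟩ : ∃ r, w + k = j + r + 1 := ⟨w + k - j - 1, by omega⟩
    have hs' : 2 * (k : ℂ) = s + 1 + j := by exact_mod_cast (by omega : 2 * k = s + 1 + j)
    have hr' : (w : ℂ) + k = j + r + 1 := by exact_mod_cast hr
    have e : (2 * (w : ℂ) - j + (s + 1)) / 2 - 1 = (r : ℂ) := by
      linear_combination hr' - hs' / 2
    rw [hs, hagenCoeff, e, genBinom_natCast, Nat.choose_eq_zero_of_lt (by omega)]
    simp

theorem norm_faulhaberCoeff_le_of_two_mul_eq_natCast (w : ℂ) (M : ℕ) (hw : 2 * w = M) :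
    ∃ C : ℝ, ∀ k, ‖faulhaberCoeff k w‖ ≤ C * 16 ^ k := by
  let f : ℕ → ℝ := fun j => |(bernoulli j : ℝ)| * (M.choose j : ℝ)
  have hf : Summable f := by
    refine summable_of_ne_finset_zero (s := Finset.range (M + 1)) fun j hj => ?_
    rw [Finset.mem_range, not_lt] at hj
    simp [f, Nat.choose_eq_zero_of_lt hj]
  refine ⟨(∑' j, f j) * ((M + 1) * 2 ^ M), fun k => ?_⟩
  rw [faulhaberCoeff_eq_sum]
  calc _ ≤ ∑ j ∈ Finset.range (2 * k + 1), f j * ((M + 1) * 2 ^ M * 16 ^ k) := by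
        refine norm_sum_le_of_le _ fun j _ => ?_
        rw [hw, genBinom_natCast, ← mul_assoc, norm_mul, norm_mul, Complex.norm_natCast,
          show ‖(bernoulli j : ℂ)‖ = |(bernoulli j : ℝ)| by
            rw [← Complex.ofReal_ratCast, Complex.norm_real, Real.norm_eq_abs]]
        rcases lt_or_ge M j with h | h
        · simp [f, Nat.choose_eq_zero_of_lt h]
        · refine mul_le_mul_of_nonneg_left ?_ (by positivity)
          have hn : ‖(M : ℂ) - j‖ ≤ M := by
            rw [← Nat.cast_sub h, Complex.norm_natCast]
            exact_mod_cast Nat.sub_le _ _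
          refine (norm_hagenCoeff_le _ M _ hn).trans ?_
          refine mul_le_mul_of_nonneg_left ?_ (by positivity)
          calc (4 : ℝ) ^ (2 * k - j) ≤ 4 ^ (2 * k) :=
                pow_le_pow_right₀ (by norm_num) (Nat.sub_le _ _)
            _ = 16 ^ k := by rw [pow_mul]; norm_num
    _ = (∑ j ∈ Finset.range (2 * k + 1), f j) * ((M + 1) * 2 ^ M * 16 ^ k) := by
        rw [Finset.sum_mul]
    _ ≤ (∑' j, f j) * ((M + 1) * 2 ^ M * 16 ^ k) := by
        refine mul_le_mul_of_nonneg_right ?_ (by positivity)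
        exact hf.sum_le_tsum _ fun j _ => by positivity
    _ = _ := by ring

theorem exists_pos_le_of_forall_pos (r : ℕ → ℝ) (hr : ∀ i, 0 < r i) (N : ℕ) :
    ∃ δ, 0 < δ ∧ ∀ i < N, δ ≤ r i := by
  induction N with
  | zero => exact ⟨1, one_pos, by simp⟩
  | succ N ih =>
    obtain ⟨δ, hδ, h⟩ := ih
    refine ⟨min δ (r N), lt_min hδ (hr N), fun i hi => ?_⟩
    rcases Nat.lt_succ_iff_lt_or_eq.1 hi with h' | rfl
    · exact (min_le_left _ _).trans (h i h')
    · exact min_le_right _ _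

/-- The factors `|a - i| / (i + 1)` are positive, and at least `1/2` once `i ≥ 2‖a‖ + 1`, so they
have a common positive lower bound. -/
theorem exists_pow_le_norm_genBinom (a : ℂ) (ha : ∀ i : ℕ, a ≠ i) :
    ∃ δ : ℝ, 0 < δ ∧ ∀ n, δ ^ n ≤ ‖genBinom a n‖ := by
  have hpos (i : ℕ) : 0 < ‖a - i‖ / ((i : ℝ) + 1) :=
    div_pos (norm_pos_iff.2 (sub_ne_zero.2 (ha i))) (by positivity)
  obtain ⟨N, hN⟩ := exists_nat_ge (2 * ‖a‖ + 1)
  obtain ⟨δ, hδ, h⟩ := exists_pos_le_of_forall_pos _ hpos N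
  refine ⟨min δ (1 / 2), lt_min hδ (by norm_num), fun n => ?_⟩
  have key (i : ℕ) : min δ (1 / 2) ≤ ‖a - i‖ / ((i : ℝ) + 1) := by
    rcases lt_or_ge i N with hi | hi
    · exact (min_le_left _ _).trans (h i hi)
    · refine (min_le_right _ _).trans ?_
      rw [le_div_iff₀ (by positivity)]
      have h1 : (N : ℝ) ≤ i := by exact_mod_cast hi
      have h2 := norm_sub_norm_le (i : ℂ) a
      rw [Complex.norm_natCast, norm_sub_rev] at h2
      linarith
  induction n with
  | zero => simp [genBinom_zero]
  | succ n ih =>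
    rw [genBinom_succ, mul_div_assoc, norm_mul, norm_div, pow_succ,
      show ‖((n : ℂ) + 1)‖ = (n : ℝ) + 1 by exact_mod_cast Complex.norm_natCast (n + 1)]
    exact mul_le_mul ih (key n) (lt_min hδ (by norm_num)).le (norm_nonneg _)

/-- Euler's formula for `ζ(2k)` together with `ζ(2k) ≥ 1`. -/
theorem factorial_le_abs_bernoulli (k : ℕ) (hk : k ≠ 0) :
    ((2 * k).factorial : ℝ) ≤ |(bernoulli (2 * k) : ℝ)| * (2 * Real.pi) ^ (2 * k) := by
  have h := hasSum_zeta_nat hk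
  have h1 : (1 : ℝ) ≤ (-1) ^ (k + 1) * 2 ^ (2 * k - 1) * Real.pi ^ (2 * k) * bernoulli (2 * k) /
      (2 * k).factorial := by
    have := h.summable.sum_le_tsum {1} fun i _ => by positivity
    rw [h.tsum_eq] at this
    simpa using this
  have hf : (0 : ℝ) < (2 * k).factorial := by exact_mod_cast Nat.factorial_pos _
  rw [le_div_iff₀ hf, one_mul] at h1
  refine (h1.trans (le_abs_self _)).trans ?_
  rw [abs_mul, abs_mul, abs_mul, abs_pow, abs_neg, abs_one, one_pow, one_mul, mul_comm, mul_pow,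
    abs_of_pos (by positivity : (0 : ℝ) < 2 ^ (2 * k - 1)),
    abs_of_pos (by positivity : (0 : ℝ) < Real.pi ^ (2 * k))]
  gcongr
  · norm_num
  · omega

/-- A geometric bound on the `A_k` would, through the convolution at `i = 2k`, bound `|B_{2k}
binom(2w, 2k)|` geometrically. The binomial is at least `δ^(2k)` while `|B_{2k}|` grows like a
factorial, a contradiction. -/
theorem exists_lt_norm_faulhaberCoeff (w : ℂ) (hw : ∀ i : ℕ, 2 * w ≠ i) (C U : ℝ) :
    ∃ k, C * U ^ k < ‖faulhaberCoeff k w‖ := by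
  by_contra! hcon
  wlog hU : 1 ≤ U ∧ 0 ≤ C generalizing C U
  · refine this |C| (|U| + 1) (fun k => (hcon k).trans ?_) ⟨by linarith [abs_nonneg U], abs_nonneg C⟩
    refine (le_abs_self _).trans ?_
    rw [abs_mul, abs_pow]
    gcongr
    linarith
  obtain ⟨hU, hC⟩ := hU
  obtain ⟨δ, hδ, hlow⟩ := exists_pow_le_norm_genBinom _ hw
  obtain ⟨N, hN⟩ := exists_nat_ge ‖w‖
  have hup (k : ℕ) : |(bernoulli (2 * k) : ℝ)| * ‖genBinom (2 * w) (2 * k)‖ ≤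
      (k + 1) * (C * U ^ k * 2 ^ (N + 2 * k)) := by
    have h := congrArg norm (bernoulli_convolution w (2 * k))
    rw [norm_mul, norm_pow, norm_neg, norm_one, one_pow, one_mul, norm_mul,
      show ‖algebraMap ℚ ℂ (bernoulli (2 * k))‖ = |(bernoulli (2 * k) : ℝ)| by
        rw [eq_ratCast, ← Complex.ofReal_ratCast, Complex.norm_real, Real.norm_eq_abs],
      show 2 * k / 2 = k by omega] at h
    rw [h]
    have hB : (k + 1) * (C * U ^ k * 2 ^ (N + 2 * k)) =
        ∑ _j ∈ Finset.range (k + 1), C * U ^ k * 2 ^ (N + 2 * k) := by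
      rw [Finset.sum_const, Finset.card_range, nsmul_eq_mul, Nat.cast_add, Nat.cast_one]
    rw [hB]
    refine norm_sum_le_of_le _ fun j hj => ?_
    have hj : j ≤ k := by simpa [Nat.lt_succ_iff] using hj
    rw [norm_mul, ← faulhaberCoeff_eq]
    refine mul_le_mul ((hcon j).trans (by gcongr)) ?_ (norm_nonneg _) (by positivity)
    refine (norm_genBinom_le _ (N + j) _ ?_).trans ?_
    · refine (norm_sub_le _ _).trans ?_
      rw [Complex.norm_natCast]
      push_cast
      linarith
    · exact pow_le_pow_right₀ (by norm_num) (by omega)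
  have hpi := Real.pi_pos
  have hmain (k : ℕ) (hk : k ≠ 0) :
      ((2 * k).factorial : ℝ) ≤ C * 2 ^ N * (8 * U * (2 * Real.pi) / δ) ^ (2 * k) := by
    have h1 := factorial_le_abs_bernoulli k hk
    have h2 : |(bernoulli (2 * k) : ℝ)| * δ ^ (2 * k) ≤ C * 2 ^ N * (8 * U) ^ (2 * k) := by
      refine (mul_le_mul_of_nonneg_left (hlow _) (abs_nonneg _)).trans ((hup k).trans ?_)
      have h3 : (k : ℝ) + 1 ≤ 2 ^ k := by exact_mod_cast Nat.lt_two_pow_self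
      calc ((k : ℝ) + 1) * (C * U ^ k * 2 ^ (N + 2 * k))
          ≤ 2 ^ k * (C * U ^ k * 2 ^ (N + 2 * k)) := by gcongr
        _ = C * 2 ^ N * (8 * U) ^ k := by
            rw [mul_pow, pow_add, pow_mul, show (8 : ℝ) = 2 * 2 ^ 2 by norm_num, mul_pow]; ring
        _ ≤ C * 2 ^ N * (8 * U) ^ (2 * k) := by
            gcongr
            · linarith
            · omega
    calc ((2 * k).factorial : ℝ) ≤ |(bernoulli (2 * k) : ℝ)| * (2 * Real.pi) ^ (2 * k) := h1
      _ = |(bernoulli (2 * k) : ℝ)| * δ ^ (2 * k) * (2 * Real.pi / δ) ^ (2 * k) := by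
          rw [div_pow]; field_simp
      _ ≤ C * 2 ^ N * (8 * U) ^ (2 * k) * (2 * Real.pi / δ) ^ (2 * k) := by gcongr
      _ = _ := by rw [mul_assoc, ← mul_pow, mul_div_assoc (8 * U)]
  have hlim := ((FloorSemiring.tendsto_pow_div_factorial_atTop
    (8 * U * (2 * Real.pi) / δ)).const_mul (C * 2 ^ N)).comp
      (tendsto_id.const_mul_atTop' (by norm_num : 0 < 2))
  rw [mul_zero] at hlim
  obtain ⟨k, hk, hk0⟩ := ((hlim.eventually_lt_const one_pos).and (eventually_ne_atTop 0)).exists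
  have hf : (0 : ℝ) < (2 * k).factorial := by exact_mod_cast Nat.factorial_pos _
  simp only [Function.comp, id, ← mul_div_assoc] at hk
  rw [div_lt_one hf] at hk
  exact absurd (hmain k hk0) (not_le.2 hk)

end Growth

/-! ### Convergence and finiteness of the series -/

section Convergence

theorem faulhaberU_eq (n : ℕ) : faulhaberU n = ((n * (n + 1) : ℕ) : ℂ) := by
  simp [faulhaberU]

theorem faulhaberU_ne_zero {n : ℕ} (hn : n ≠ 0) : faulhaberU n ≠ 0 := by
  rw [faulhaberU_eq]
  exact_mod_cast mul_ne_zero hn n.succ_ne_zero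

theorem norm_faulhaberTerm {n : ℕ} (hn : n ≠ 0) (α : ℂ) (k : ℕ) : ‖faulhaberTerm α n k‖ =
    ‖1 / (α + 1)‖ * ‖faulhaberU n ^ ((α + 1) / 2)‖ *
      (‖faulhaberCoeff k ((α + 1) / 2)‖ / ‖faulhaberU n‖ ^ k) := by
  rw [faulhaberTerm, Complex.cpow_sub _ _ (faulhaberU_ne_zero hn), Complex.cpow_natCast, norm_mul,
    norm_mul, norm_div (faulhaberU n ^ _), norm_pow]
  ring

theorem faulhaberSeries_converges_iff (α : ℂ) (hα : α ≠ -1) :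
    (∀ᶠ n : ℕ in atTop, ∃ s : ℂ,
      Tendsto (fun K : ℕ => ∑ k ∈ Finset.range K, faulhaberTerm α n k) atTop (𝓝 s)) ↔
        ∃ m : ℕ, α = (m : ℂ) := by
  have hα' : α + 1 ≠ 0 := fun h => hα (eq_neg_of_add_eq_zero_left h)
  have h2w : 2 * ((α + 1) / 2) = α + 1 := by ring
  constructor
  · intro h
    obtain ⟨n, ⟨s, hs⟩, hn⟩ := (h.and (eventually_ne_atTop 0)).exists
    by_contra! hcon
    have hw (i : ℕ) : 2 * ((α + 1) / 2) ≠ i := by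
      rw [h2w]
      rcases i with _ | i
      · simpa using hα'
      · simpa using hcon i
    have h0 : Tendsto (fun K => faulhaberTerm α n K) atTop (𝓝 0) := by
      have := (hs.comp (tendsto_add_atTop_nat 1)).sub hs
      simpa [Finset.sum_range_succ] using this
    obtain ⟨C, hC⟩ := h0.norm.bddAbove_range
    have hU : 0 < ‖faulhaberU n‖ := norm_pos_iff.2 (faulhaberU_ne_zero hn)
    have hD : 0 < ‖1 / (α + 1)‖ * ‖faulhaberU n ^ ((α + 1) / 2)‖ := by
      refine mul_pos (norm_pos_iff.2 (one_div_ne_zero hα')) (norm_pos_iff.2 ?_)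
      exact fun h => faulhaberU_ne_zero hn (Complex.cpow_eq_zero_iff _ _ |>.1 h).1
    obtain ⟨k, hk⟩ := exists_lt_norm_faulhaberCoeff _ hw
      -- Convergence at a single `n` would bound the terms, forcing geometric growth of the
      -- coefficients with ratio `|u|`.
      (C / (‖1 / (α + 1)‖ * ‖faulhaberU n ^ ((α + 1) / 2)‖)) ‖faulhaberU n‖
    have h1 := hC ⟨k, rfl⟩
    dsimp only at h1
    rw [norm_faulhaberTerm hn, ← le_div_iff₀' hD, div_le_iff₀ (pow_pos hU k)] at h1
    exact absurd hk (not_lt.2 h1)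
  · rintro ⟨m, rfl⟩
    obtain ⟨C, hC⟩ := norm_faulhaberCoeff_le_of_two_mul_eq_natCast (((m : ℂ) + 1) / 2) (m + 1)
      (by push_cast; ring)
    filter_upwards [eventually_ge_atTop 16] with n hn
    have hn0 : n ≠ 0 := by omega
    have hU : 16 < ‖faulhaberU n‖ := by
      rw [faulhaberU_eq, Complex.norm_natCast]
      exact_mod_cast (by nlinarith : 16 < n * (n + 1))
    have hsum : Summable (faulhaberTerm (m : ℂ) n) := by
      refine Summable.of_norm_bounded (g := fun k => ‖1 / ((m : ℂ) + 1)‖ *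
        ‖faulhaberU n ^ (((m : ℂ) + 1) / 2)‖ * (C * (16 / ‖faulhaberU n‖) ^ k)) ?_ fun k => ?_
      · refine ((summable_geometric_of_lt_one (by positivity) ?_).mul_left _).mul_left _
        rwa [div_lt_one (by linarith)]
      · rw [norm_faulhaberTerm hn0, div_pow, ← mul_div_assoc C]
        exact mul_le_mul_of_nonneg_left (div_le_div_of_nonneg_right (hC k) (by positivity))
          (by positivity)
    exact ⟨_, hsum.hasSum.tendsto_sum_nat⟩

theorem faulhaberCoeff_finite_support_of_odd (α : ℂ) (h : ∃ m : ℕ, α = 2 * (m : ℂ) + 1) :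
    {k : ℕ | faulhaberCoeff k ((α + 1) / 2) ≠ 0}.Finite := by
  obtain ⟨m, rfl⟩ := h
  refine (Set.finite_Iic (m + 1)).subset fun k hk => ?_
  by_contra hlt
  refine hk ?_
  rw [show (2 * (m : ℂ) + 1 + 1) / 2 = ((m + 1 : ℕ) : ℂ) by push_cast; ring]
  exact faulhaberCoeff_natCast_eq_zero _ _ (not_le.1 hlt)

end Convergence

/-! ### The complex binomial series with remainder -/

section BinomialSeries

theorem ringChoose_eq_genBinom (a : ℂ) (n : ℕ) : Ring.choose a n = genBinom a n := by
  rw [Ring.choose_eq_smul, genBinom, smul_eq_mul, div_eq_inv_mul]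
  congr 1
  induction n with
  | zero => simp
  | succ n ih =>
    rw [descPochhammer_succ_right, Polynomial.smeval_mul, ih, Finset.prod_range_succ,
      Polynomial.smeval_sub, Polynomial.smeval_X, Polynomial.smeval_natCast]
    simp

theorem hasSum_genBinom (a t : ℂ) (ht : ‖t‖ < 1) :
    HasSum (fun n => genBinom a n * t ^ n) ((1 + t) ^ a) := by
  have h := Complex.one_add_cpow_hasFPowerSeriesOnBall_zero (a := a)
  have h1 := h.hasSum (y := t) (by simpa [← ofReal_norm] using ht)
  simpa [binomialSeries, FormalMultilinearSeries.coeff_ofScalars, ringChoose_eq_genBinom,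
    mul_comm] using h1

theorem norm_one_add_cpow_sub_le (a t : ℂ) (N m : ℕ) (ha : ‖a‖ ≤ N) (ht : ‖t‖ ≤ 1 / 4) :
    ‖(1 + t) ^ a - ∑ i ∈ Finset.range m, genBinom a i * t ^ i‖ ≤ 2 ^ (N + m + 1) * ‖t‖ ^ m := by
  have h := (hasSum_nat_add_iff' m).2 (hasSum_genBinom a t (by linarith))
  rw [← h.tsum_eq]
  have hg := (hasSum_geometric_of_lt_one (r := 2 * ‖t‖) (by positivity)
    (by linarith)).mul_left (2 ^ (N + m) * ‖t‖ ^ m)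
  refine (tsum_of_norm_bounded hg fun i => ?_).trans ?_
  · rw [norm_mul, norm_pow]
    calc _ ≤ 2 ^ (N + (i + m)) * ‖t‖ ^ (i + m) := by
          gcongr
          exact norm_genBinom_le a N _ ha
      _ = _ := by rw [mul_pow]; ring
  · have : (1 - 2 * ‖t‖)⁻¹ ≤ 2 := inv_le_of_inv_le₀ (by norm_num) (by linarith)
    calc 2 ^ (N + m) * ‖t‖ ^ m * (1 - 2 * ‖t‖)⁻¹ ≤ 2 ^ (N + m) * ‖t‖ ^ m * 2 := by gcongr
      _ = _ := by ring

end BinomialSeries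

/-! ### Telescoping the truncated series -/

section Telescoping

theorem sum_range_mul_two_sub {M : Type*} [AddCommMonoid M] (P : ℕ) (g : ℕ → ℕ → M) :
    ∑ k ∈ Finset.range P, ∑ i ∈ Finset.range (2 * P - 2 * k), g k i =
      ∑ m ∈ Finset.range (2 * P), ∑ k ∈ Finset.range (m / 2 + 1), g k (m - 2 * k) := by
  rw [Finset.sum_sigma', Finset.sum_sigma']
  refine Finset.sum_nbij' (fun x => ⟨x.2 + 2 * x.1, x.1⟩) (fun y => ⟨y.2, y.1 - 2 * y.2⟩)
    ?_ ?_ ?_ ?_ ?_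
  · rintro ⟨k, i⟩ h
    simp only [Finset.mem_sigma, Finset.mem_range] at h ⊢
    omega
  · rintro ⟨m, k⟩ h
    simp only [Finset.mem_sigma, Finset.mem_range] at h ⊢
    omega
  · rintro ⟨k, i⟩ h
    simp
  · rintro ⟨m, k⟩ h
    simp only [Finset.mem_sigma, Finset.mem_range] at h
    simp only [Sigma.mk.injEq, heq_eq_eq, and_true]
    omega
  · rintro ⟨k, i⟩ h
    simp

/-- Collected by powers of `t`, the coefficient of `t^m` is a multiple of `(1 - (-1)^m) B_m`. Even
`m` cancel, odd `m ≥ 3` have `B_m = 0`, and `B_1 = -1/2` leaves `2wt`. -/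
theorem sum_faulhaberCoeff_binomial_difference (w t : ℂ) (P : ℕ) (hP : P ≠ 0) :
    ∑ k ∈ Finset.range P, faulhaberCoeff k w * t ^ (2 * k) *
      (∑ i ∈ Finset.range (2 * P - 2 * k + 1), genBinom (w - k) i * t ^ i -
        ∑ i ∈ Finset.range (2 * P - 2 * k + 1), genBinom (w - k) i * (-t) ^ i) = 2 * w * t := by
  have h1 (k : ℕ) : faulhaberCoeff k w * t ^ (2 * k) *
      (∑ i ∈ Finset.range (2 * P - 2 * k + 1), genBinom (w - k) i * t ^ i -
        ∑ i ∈ Finset.range (2 * P - 2 * k + 1), genBinom (w - k) i * (-t) ^ i) =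
      ∑ i ∈ Finset.range (2 * P - 2 * k), faulhaberCoeff k w * genBinom (w - k) i *
        ((1 - (-1) ^ (i + 2 * k)) * t ^ (i + 2 * k)) := by
    -- The top power of `t` is even and cancels, so keeping it is free and improves the later
    -- remainder by one order.
    have he : Even (2 * P - 2 * k) := ⟨P - k, by omega⟩
    rw [Finset.sum_range_succ, Finset.sum_range_succ, he.neg_pow, add_sub_add_right_eq_sub,
      ← Finset.sum_sub_distrib, Finset.mul_sum]
    refine Finset.sum_congr rfl fun i _ => ?_
    rw [neg_pow t, pow_add, pow_add, pow_mul (-1 : ℂ)]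
    ring
  rw [Finset.sum_congr rfl fun k _ => h1 k, sum_range_mul_two_sub P fun k i =>
    faulhaberCoeff k w * genBinom (w - k) i * ((1 - (-1) ^ (i + 2 * k)) * t ^ (i + 2 * k))]
  have h2 (m : ℕ) : ∑ k ∈ Finset.range (m / 2 + 1), faulhaberCoeff k w *
      genBinom (w - k) (m - 2 * k) *
        ((1 - (-1) ^ (m - 2 * k + 2 * k)) * t ^ (m - 2 * k + 2 * k)) =
      (-1) ^ m * ((bernoulli m : ℂ) * genBinom (2 * w) m) * ((1 - (-1) ^ m) * t ^ m) := by
    have := bernoulli_convolution w m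
    rw [eq_ratCast] at this
    rw [this, Finset.sum_mul]
    refine Finset.sum_congr rfl fun k hk => ?_
    rw [Finset.mem_range] at hk
    rw [Nat.sub_add_cancel (by omega), faulhaberCoeff_eq]
  rw [Finset.sum_congr rfl fun m _ => h2 m, Finset.sum_eq_single 1]
  · rw [bernoulli_one, genBinom_one]
    push_cast
    ring
  · intro m _ hm
    rcases Nat.even_or_odd m with h | h
    · simp [h.neg_one_pow]
    · rw [bernoulli_eq_zero_of_odd h (by rcases h with ⟨r, rfl⟩; omega)]
      simp
  · intro h
    exact absurd (Finset.mem_range.2 (by omega)) h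

/-- The truncated Faulhaber series, without the factor `1 / (α + 1)`. -/
noncomputable def faulhaberPartial (P : ℕ) (w : ℂ) (n : ℕ) : ℂ :=
  ∑ k ∈ Finset.range P, faulhaberCoeff k w * faulhaberU n ^ (w - k)

/-- The error of the truncated Faulhaber series, up to a constant. -/
noncomputable def faulhaberError (P : ℕ) (w : ℂ) (n : ℕ) : ℂ :=
  2 * w * ∑ k ∈ Finset.Icc 1 n, (k : ℂ) ^ (2 * w - 1) - faulhaberPartial P w n

theorem cpow_sub_natCast_of_sq_mul (x : ℕ) (hx : x ≠ 0) (w : ℂ) (k : ℕ) (r : ℝ) (hr : 0 ≤ r) :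
    ((x : ℂ) ^ 2 * (r : ℂ)) ^ (w - k) =
      (x : ℂ) ^ (2 * w) * (((x : ℂ)⁻¹) ^ (2 * k) * (r : ℂ) ^ (w - k)) := by
  have hx' : (x : ℂ) ≠ 0 := Nat.cast_ne_zero.2 hx
  have h1 : ((x : ℂ) ^ 2 * (r : ℂ)) ^ (w - k) = ((x : ℂ) ^ 2) ^ (w - k) * (r : ℂ) ^ (w - k) := by
    have := Complex.mul_cpow_ofReal_nonneg (a := (x : ℝ) ^ 2) (b := r) (by positivity) hr (w - k)
    simpa using this
  have h2 : ((x : ℂ) ^ 2) ^ (w - k) = (x : ℂ) ^ (2 * w) * ((x : ℂ)⁻¹) ^ (2 * k) := by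
    have h3 := Complex.natCast_mul_natCast_cpow x x (w - k)
    rw [sq, h3, ← Complex.cpow_add _ _ hx', show w - k + (w - k) = 2 * w - (2 * k : ℕ) by
      push_cast; ring, Complex.cpow_sub _ _ hx', Complex.cpow_natCast, inv_pow, div_eq_mul_inv]
  rw [h1, h2, mul_assoc]

/-- With `x = n + 1`, the two values of `u` are `x²(1 + 1/x)` and `x²(1 - 1/x)`. The Taylor parts at
`t = 1/x` cancel exactly the new summand `2w x^(2w - 1)`, so only remainders survive. -/
theorem faulhaberError_succ_sub (P : ℕ) (hP : P ≠ 0) (w : ℂ) (n : ℕ) (hn : n ≠ 0) :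
    faulhaberError P w (n + 1) - faulhaberError P w n =
      ((n + 1 : ℕ) : ℂ) ^ (2 * w) * ∑ k ∈ Finset.range P,
        faulhaberCoeff k w * (((n + 1 : ℕ) : ℂ)⁻¹) ^ (2 * k) *
        (((1 + -(((n + 1 : ℕ) : ℂ)⁻¹)) ^ (w - k) - ∑ i ∈ Finset.range (2 * P - 2 * k + 1),
            genBinom (w - k) i * (-(((n + 1 : ℕ) : ℂ)⁻¹)) ^ i) -
          ((1 + (((n + 1 : ℕ) : ℂ)⁻¹)) ^ (w - k) - ∑ i ∈ Finset.range (2 * P - 2 * k + 1),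
            genBinom (w - k) i * (((n + 1 : ℕ) : ℂ)⁻¹) ^ i)) := by
  have hx : ((n + 1 : ℕ) : ℂ) ≠ 0 := Nat.cast_ne_zero.2 n.succ_ne_zero
  have hu1 : faulhaberU (n + 1) =
      ((n + 1 : ℕ) : ℂ) ^ 2 * ((1 + (((n + 1 : ℕ) : ℝ))⁻¹ : ℝ) : ℂ) := by
    rw [faulhaberU]
    push_cast at hx ⊢
    field_simp
  have hu0 : faulhaberU n =
      ((n + 1 : ℕ) : ℂ) ^ 2 * ((1 + -(((n + 1 : ℕ) : ℝ))⁻¹ : ℝ) : ℂ) := by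
    rw [faulhaberU]
    push_cast at hx ⊢
    field_simp
    ring
  have hle : (((n + 1 : ℕ) : ℝ))⁻¹ ≤ 1 := inv_le_one_of_one_le₀ (by exact_mod_cast Nat.le_add_left 1 n)
  have hsum := sum_faulhaberCoeff_binomial_difference w (((n + 1 : ℕ) : ℂ)⁻¹) P hP
  have hpow : 2 * w * ((n + 1 : ℕ) : ℂ) ^ (2 * w - 1) =
      ((n + 1 : ℕ) : ℂ) ^ (2 * w) * (2 * w * ((n + 1 : ℕ) : ℂ)⁻¹) := by
    rw [Complex.cpow_sub _ _ hx, Complex.cpow_one]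
    ring
  have hG : faulhaberPartial P w (n + 1) - faulhaberPartial P w n =
      ((n + 1 : ℕ) : ℂ) ^ (2 * w) * ∑ k ∈ Finset.range P,
        faulhaberCoeff k w * (((n + 1 : ℕ) : ℂ)⁻¹) ^ (2 * k) *
        ((1 + (((n + 1 : ℕ) : ℂ)⁻¹)) ^ (w - k) - (1 + -(((n + 1 : ℕ) : ℂ)⁻¹)) ^ (w - k)) := by
    rw [faulhaberPartial, faulhaberPartial, ← Finset.sum_sub_distrib, Finset.mul_sum]
    refine Finset.sum_congr rfl fun k _ => ?_
    rw [hu1, hu0, cpow_sub_natCast_of_sq_mul _ n.succ_ne_zero _ _ _ (by positivity),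
      cpow_sub_natCast_of_sq_mul _ n.succ_ne_zero _ _ _ (by linarith)]
    simp only [Complex.ofReal_add, Complex.ofReal_neg, Complex.ofReal_inv, Complex.ofReal_one,
      Complex.ofReal_natCast]
    ring
  have hE : faulhaberError P w (n + 1) - faulhaberError P w n =
      2 * w * ((n + 1 : ℕ) : ℂ) ^ (2 * w - 1) -
        (faulhaberPartial P w (n + 1) - faulhaberPartial P w n) := by
    rw [faulhaberError, faulhaberError, Finset.sum_Icc_succ_top (Nat.le_add_left 1 n)]
    ring
  rw [hE, hpow, hG, ← hsum, ← mul_sub, ← Finset.sum_sub_distrib]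
  congr 1
  refine Finset.sum_congr rfl fun k _ => ?_
  ring

theorem differentiable_faulhaberCoeff (k : ℕ) : Differentiable ℂ (faulhaberCoeff k) := by
  have : faulhaberCoeff k = fun w => Polynomial.aeval w (faulhaberPoly k) :=
    funext (faulhaberCoeff_eq k)
  rw [this]
  exact Polynomial.differentiable_aeval _

theorem exists_norm_faulhaberCoeff_le (R : ℝ) (k : ℕ) :
    ∃ M, 0 ≤ M ∧ ∀ w : ℂ, ‖w‖ ≤ R → ‖faulhaberCoeff k w‖ ≤ M := by
  obtain ⟨M, hM⟩ := (isCompact_closedBall (0 : ℂ) R).exists_bound_of_continuousOn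
    (differentiable_faulhaberCoeff k).continuous.continuousOn
  exact ⟨max M 0, le_max_right _ _, fun w hw => (hM w (by simpa using hw)).trans (le_max_left _ _)⟩

/-- The remainders are `O(x^(-2P - 1))` and the prefactor is at most `x^(2R)`, where `x = n + 1`;
the condition on `P` makes the exponent at most `-(q + 2)`. Uniformity in `w` is what makes the
limit analytic. -/
theorem exists_norm_faulhaberError_succ_sub_le (R q P : ℕ) (hP : R + q + 1 ≤ P) :
    ∃ K : ℝ, 0 ≤ K ∧ ∀ w : ℂ, ‖w‖ ≤ R → ∀ n : ℕ, 3 ≤ n →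
      ‖faulhaberError P w (n + 1) - faulhaberError P w n‖ ≤ K / ((n : ℝ) + 1) ^ (q + 2) := by
  choose M hM0 hM using exists_norm_faulhaberCoeff_le (R : ℝ)
  refine ⟨∑ k ∈ Finset.range P, M k * (2 * 2 ^ ((R + P) + (2 * P + 1) + 1)),
    Finset.sum_nonneg fun k _ => mul_nonneg (hM0 k) (by positivity), fun w hw n hn => ?_⟩
  rw [faulhaberError_succ_sub P (by omega) w n (by omega), norm_mul,
    Complex.norm_natCast_cpow_of_pos n.succ_pos]
  have hx1 : (1 : ℝ) ≤ (n : ℝ) + 1 := by linarith [n.cast_nonneg (α := ℝ)]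
  have hx0 : (0 : ℝ) < (n : ℝ) + 1 := by linarith
  set t : ℂ := (((n + 1 : ℕ) : ℂ)⁻¹) with ht
  have htn : ‖t‖ = ((n : ℝ) + 1)⁻¹ := by
    rw [ht, norm_inv, Complex.norm_natCast]; push_cast; rfl
  have ht4 : ‖t‖ ≤ 1 / 4 := by
    rw [htn, one_div]
    refine inv_anti₀ (by norm_num) ?_
    have : (3 : ℝ) ≤ n := by exact_mod_cast hn
    linarith
  have hsum : ‖∑ k ∈ Finset.range P, faulhaberCoeff k w * t ^ (2 * k) *
        (((1 + -t) ^ (w - k) - ∑ i ∈ Finset.range (2 * P - 2 * k + 1),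
            genBinom (w - k) i * (-t) ^ i) -
          ((1 + t) ^ (w - k) - ∑ i ∈ Finset.range (2 * P - 2 * k + 1),
            genBinom (w - k) i * t ^ i))‖ ≤
      (∑ k ∈ Finset.range P, M k * (2 * 2 ^ ((R + P) + (2 * P + 1) + 1))) * ‖t‖ ^ (2 * P + 1) := by
    rw [Finset.sum_mul]
    refine norm_sum_le_of_le _ fun k hk => ?_
    rw [Finset.mem_range] at hk
    have hwk : ‖w - k‖ ≤ (R + P : ℕ) := by
      refine (norm_sub_le _ _).trans ?_
      have : (k : ℝ) ≤ P := by exact_mod_cast hk.le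
      rw [Complex.norm_natCast]
      push_cast
      linarith
    have h1 := norm_one_add_cpow_sub_le (w - k) t _ (2 * P - 2 * k + 1) hwk ht4
    have h2 := norm_one_add_cpow_sub_le (w - k) (-t) _ (2 * P - 2 * k + 1) hwk (by rwa [norm_neg])
    rw [norm_neg] at h2
    have h3 : (2 : ℝ) ^ (R + P + (2 * P - 2 * k + 1) + 1) ≤ 2 ^ ((R + P) + (2 * P + 1) + 1) :=
      pow_le_pow_right₀ (by norm_num) (by omega)
    rw [norm_mul, norm_mul, norm_pow]
    calc _ ≤ M k * ‖t‖ ^ (2 * k) * (2 * (2 ^ ((R + P) + (2 * P + 1) + 1) *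
          ‖t‖ ^ (2 * P - 2 * k + 1))) := by
          refine mul_le_mul (mul_le_mul_of_nonneg_right (hM k w hw) (by positivity)) ?_
            (norm_nonneg _) (mul_nonneg (hM0 k) (by positivity))
          refine (norm_sub_le _ _).trans ?_
          have h4 := mul_le_mul_of_nonneg_right h3
            (by positivity : 0 ≤ ‖t‖ ^ (2 * P - 2 * k + 1))
          linarith
      _ = M k * (2 * 2 ^ ((R + P) + (2 * P + 1) + 1)) *
            (‖t‖ ^ (2 * k) * ‖t‖ ^ (2 * P - 2 * k + 1)) := by ring
      _ = _ := by rw [← pow_add, show 2 * k + (2 * P - 2 * k + 1) = 2 * P + 1 by omega]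
  have hre : (2 * w).re ≤ (2 * R : ℕ) := by
    have := (Complex.re_le_norm w).trans hw
    simp only [Complex.mul_re, Complex.re_ofNat, Complex.im_ofNat, zero_mul, sub_zero]
    push_cast
    linarith
  have hpow : (((n + 1 : ℕ) : ℝ)) ^ (2 * w).re ≤ ((n : ℝ) + 1) ^ (2 * R) := by
    rw [← Real.rpow_natCast]
    push_cast at hre ⊢
    exact Real.rpow_le_rpow_of_exponent_le hx1 hre
  calc _ ≤ ((n : ℝ) + 1) ^ (2 * R) * ((∑ k ∈ Finset.range P,
          M k * (2 * 2 ^ ((R + P) + (2 * P + 1) + 1))) * ‖t‖ ^ (2 * P + 1)) :=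
        mul_le_mul hpow hsum (norm_nonneg _) (by positivity)
    _ = (∑ k ∈ Finset.range P, M k * (2 * 2 ^ ((R + P) + (2 * P + 1) + 1))) *
          (((n : ℝ) + 1) ^ (2 * R) / ((n : ℝ) + 1) ^ (2 * P + 1)) := by
        rw [htn, inv_pow]; ring
    _ ≤ _ := by
        rw [div_eq_mul_one_div _ (((n : ℝ) + 1) ^ (q + 2))]
        refine mul_le_mul_of_nonneg_left ?_
          (Finset.sum_nonneg fun k _ => mul_nonneg (hM0 k) (by positivity))
        rw [div_le_div_iff₀ (by positivity) (by positivity), one_mul, ← pow_add]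
        exact pow_le_pow_right₀ hx1 (by omega)

end Telescoping

/-! ### Identifying the constant by analytic continuation -/

section Continuation

/-- The entire function `2 w ζ(1 - 2 w)`. -/
noncomputable def zetaFactor : ℂ → ℂ :=
  Function.update (fun w => 2 * w * riemannZeta (1 - 2 * w)) 0 (-1)

theorem zetaFactor_of_ne_zero {w : ℂ} (hw : w ≠ 0) :
    zetaFactor w = 2 * w * riemannZeta (1 - 2 * w) := Function.update_of_ne hw _ _

theorem differentiableAt_two_mul_zeta {w : ℂ} (hw : w ≠ 0) :
    DifferentiableAt ℂ (fun w => 2 * w * riemannZeta (1 - 2 * w)) w := by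
  have h1 : DifferentiableAt ℂ riemannZeta (1 - 2 * w) :=
    differentiableAt_riemannZeta (by simpa using hw)
  have h2 : DifferentiableAt ℂ (fun w : ℂ => 1 - 2 * w) w := by fun_prop
  exact (by fun_prop : DifferentiableAt ℂ (fun w : ℂ => 2 * w) w).mul (h1.comp w h2)

/-- With `s = 1 - 2w` the function is `-(s - 1) ζ(s)`; the residue 1 of `ζ` at 1 makes the
singularity at `w = 0` removable, with value `-1`. -/
theorem analyticOnNhd_zetaFactor : AnalyticOnNhd ℂ zetaFactor Set.univ := by
  have hne {w : ℂ} (hw : w ≠ 0) : DifferentiableAt ℂ zetaFactor w := by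
    refine (differentiableAt_two_mul_zeta hw).congr_of_eventuallyEq ?_
    filter_upwards [isOpen_ne.mem_nhds hw] with z hz using zetaFactor_of_ne_zero hz
  refine Complex.analyticOnNhd_univ_iff_differentiable.2 fun w => ?_
  rcases eq_or_ne w 0 with rfl | hw
  · refine (Complex.analyticAt_of_differentiable_on_punctured_nhds_of_continuousAt
      (eventually_nhdsWithin_of_forall fun z hz => hne hz) ?_).differentiableAt
    refine continuousAt_update_same.2 ?_
    have h : Tendsto (fun w : ℂ => 1 - 2 * w) (𝓝[≠] 0) (𝓝[≠] 1) := by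
      refine tendsto_nhdsWithin_iff.2 ⟨?_, ?_⟩
      · refine tendsto_nhdsWithin_of_tendsto_nhds ?_
        have : Continuous fun w : ℂ => 1 - 2 * w := by fun_prop
        simpa using this.tendsto 0
      · exact eventually_nhdsWithin_of_forall fun z hz => by simpa using hz
    refine ((riemannZeta_residue_one.comp h).neg).congr fun z => ?_
    simp only [Function.comp]
    ring
  · exact hne hw

theorem norm_faulhaberU_cpow {n : ℕ} (hn : n ≠ 0) (s : ℂ) :
    ‖faulhaberU n ^ s‖ = ((n : ℝ) * (n + 1)) ^ s.re := by
  rw [faulhaberU_eq, Complex.norm_natCast_cpow_of_pos (by positivity)]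
  push_cast
  rfl

theorem tendsto_faulhaberU_cpow (s : ℂ) (hs : s.re < 0) :
    Tendsto (fun n => faulhaberU n ^ s) atTop (𝓝 0) := by
  rw [tendsto_zero_iff_norm_tendsto_zero]
  have h1 : Tendsto (fun n : ℕ => ((n : ℝ) * (n + 1))) atTop atTop :=
    tendsto_natCast_atTop_atTop.atTop_mul_atTop₀
      (tendsto_atTop_add_const_right _ _ tendsto_natCast_atTop_atTop)
  have h2 := (tendsto_rpow_neg_atTop (neg_pos.2 hs)).comp h1
  rw [neg_neg] at h2
  refine h2.congr' ?_
  filter_upwards [eventually_ne_atTop 0] with n hn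
  exact (norm_faulhaberU_cpow hn s).symm

theorem tendsto_faulhaberPartial (P : ℕ) (w : ℂ) (hw : w.re < 0) :
    Tendsto (faulhaberPartial P w) atTop (𝓝 0) := by
  have : Tendsto (fun n => ∑ k ∈ Finset.range P, faulhaberCoeff k w * faulhaberU n ^ (w - k))
      atTop (𝓝 (∑ k ∈ Finset.range P, faulhaberCoeff k w * 0)) := by
    refine tendsto_finsetSum _ fun k _ => (tendsto_faulhaberU_cpow _ ?_).const_mul _
    rw [Complex.sub_re, Complex.natCast_re]
    linarith [k.cast_nonneg (α := ℝ)]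
  simp only [mul_zero, Finset.sum_const_zero] at this
  exact this

theorem tendsto_sum_Icc_cpow (α : ℂ) (hα : α.re < -1) :
    Tendsto (fun n : ℕ => ∑ k ∈ Finset.Icc 1 n, (k : ℂ) ^ α) atTop (𝓝 (riemannZeta (-α))) := by
  have hre : 1 < (-α).re := by rw [Complex.neg_re]; linarith
  have h0 : α ≠ 0 := by rintro rfl; norm_num at hα
  rw [zeta_eq_tsum_one_div_nat_cpow hre]
  have h := (Complex.summable_one_div_nat_cpow.2 hre).hasSum.tendsto_sum_nat.comp
    (tendsto_add_atTop_nat 1)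
  refine h.congr fun n => ?_
  simp only [Function.comp]
  rw [Finset.range_eq_Ico, Finset.sum_eq_sum_Ico_succ_bot (Nat.add_one_pos n), Nat.cast_zero,
    Complex.zero_cpow (neg_ne_zero.2 h0), div_zero, zero_add, zero_add,
    Finset.Ico_add_one_right_eq_Icc]
  refine Finset.sum_congr rfl fun k _ => ?_
  rw [Complex.cpow_neg, one_div, inv_inv]

theorem tendsto_faulhaberError_of_re_neg (P : ℕ) (w : ℂ) (hw : w.re < 0) :
    Tendsto (faulhaberError P w) atTop (𝓝 (zetaFactor w)) := by
  have hne : w ≠ 0 := by rintro rfl; norm_num at hw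
  have h1 := tendsto_sum_Icc_cpow (2 * w - 1) (by
    simp only [Complex.sub_re, Complex.mul_re, Complex.re_ofNat, Complex.im_ofNat, zero_mul,
      sub_zero, Complex.one_re]
    linarith)
  have h2 := (h1.const_mul (2 * w)).sub (tendsto_faulhaberPartial P w hw)
  rw [sub_zero, neg_sub] at h2
  rw [zetaFactor_of_ne_zero hne]
  exact h2

theorem differentiable_faulhaberError (P n : ℕ) (hn : n ≠ 0) :
    Differentiable ℂ fun w => faulhaberError P w n := by
  intro w
  have h1 : DifferentiableAt ℂ (fun w : ℂ => ∑ k ∈ Finset.Icc 1 n, (k : ℂ) ^ (2 * w - 1)) w := by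
    refine DifferentiableAt.fun_sum fun k hk => ?_
    have hk0 : (k : ℂ) ≠ 0 := Nat.cast_ne_zero.2 (by rw [Finset.mem_Icc] at hk; omega)
    exact (by fun_prop : DifferentiableAt ℂ (fun w : ℂ => 2 * w - 1) w).const_cpow (Or.inl hk0)
  have h2 : DifferentiableAt ℂ (fun w => faulhaberPartial P w n) w := by
    refine DifferentiableAt.fun_sum fun k _ => (differentiable_faulhaberCoeff k w).mul ?_
    exact (by fun_prop : DifferentiableAt ℂ (fun w : ℂ => w - k) w).const_cpow
      (Or.inl (faulhaberU_ne_zero hn))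
  exact ((by fun_prop : DifferentiableAt ℂ (fun w : ℂ => 2 * w) w).mul h1).sub h2

theorem summable_one_div_succ_pow (q c : ℕ) :
    Summable fun n : ℕ => 1 / (((n + c : ℕ) : ℝ) + 1) ^ (q + 2) := by
  have h := (summable_nat_add_iff (c + 1)).2
    (Real.summable_one_div_nat_pow.2 (by omega : 1 < q + 2))
  refine h.congr fun n => ?_
  push_cast
  ring_nf

/-- The increments are summable uniformly on the disc, so the limit is analytic there. It equals
`zetaFactor` near `-1`, a point of the disc because `R ≥ 2`, and hence on the whole disc. -/
theorem tendsto_faulhaberError (R P : ℕ) (hR : 2 ≤ R) (hP : R + 1 ≤ P) (w : ℂ) (hw : ‖w‖ < R) :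
    Tendsto (faulhaberError P w) atTop (𝓝 (zetaFactor w)) := by
  obtain ⟨K, hK0, hK⟩ := exists_norm_faulhaberError_succ_sub_le R 0 P (by omega)
  let d : ℕ → ℂ → ℂ := fun n w => faulhaberError P w (n + 3 + 1) - faulhaberError P w (n + 3)
  have hd (n : ℕ) (z : ℂ) (hz : z ∈ Metric.ball (0 : ℂ) R) :
      ‖d n z‖ ≤ K * (1 / (((n + 3 : ℕ) : ℝ) + 1) ^ (0 + 2)) := by
    rw [mul_one_div]
    exact hK z (by simpa using (mem_ball_zero_iff.1 hz).le) _ (by omega)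
  have hs : Summable fun n : ℕ => K * (1 / (((n + 3 : ℕ) : ℝ) + 1) ^ (0 + 2)) :=
    (summable_one_div_succ_pow 0 3).mul_left K
  let c : ℂ → ℂ := fun w => faulhaberError P w 3 + ∑' n, d n w
  have hc : DifferentiableOn ℂ c (Metric.ball 0 R) := by
    refine (differentiable_faulhaberError P 3 (by norm_num)).differentiableOn.add ?_
    refine Complex.differentiableOn_tsum_of_summable_norm hs (fun n => ?_) Metric.isOpen_ball hd
    exact ((differentiable_faulhaberError P _ (by omega)).sub
      (differentiable_faulhaberError P _ (by omega))).differentiableOn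
  have hlim (z : ℂ) (hz : z ∈ Metric.ball (0 : ℂ) R) :
      Tendsto (faulhaberError P z) atTop (𝓝 (c z)) := by
    have h1 := (Summable.of_norm_bounded hs fun n => hd n z hz).hasSum.tendsto_sum_nat.const_add
      (faulhaberError P z 3)
    refine (tendsto_add_atTop_iff_nat 3).1 (h1.congr fun n => ?_)
    have := Finset.sum_range_sub (fun n => faulhaberError P z (n + 3)) n
    simp only [zero_add, show ∀ i, i + 1 + 3 = i + 3 + 1 from fun i => by omega] at this
    simp only [d]
    rw [this]
    ring
  have heq : Set.EqOn c zetaFactor (Metric.ball 0 R) := by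
    have hR' : (2 : ℝ) ≤ R := by exact_mod_cast hR
    have hmem : (-1 : ℂ) ∈ Metric.ball (0 : ℂ) R := by
      rw [mem_ball_zero_iff, norm_neg, norm_one]; linarith
    refine (hc.analyticOnNhd Metric.isOpen_ball).eqOn_of_preconnected_of_eventuallyEq
      (analyticOnNhd_zetaFactor.mono (Set.subset_univ _))
      (convex_ball (0 : ℂ) R).isPreconnected hmem ?_
    have hneg : ∀ᶠ z : ℂ in 𝓝 (-1), z.re < 0 :=
      (isOpen_lt Complex.continuous_re continuous_const).mem_nhds (by simp)
    filter_upwards [Metric.isOpen_ball.mem_nhds hmem, hneg] with z hz hz'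
    exact tendsto_nhds_unique (hlim z hz) (tendsto_faulhaberError_of_re_neg P z hz')
  have hmem : w ∈ Metric.ball (0 : ℂ) R := mem_ball_zero_iff.2 hw
  rw [← heq hmem]
  exact hlim w hmem

theorem exists_norm_faulhaberError_sub_le (R q P : ℕ) (hR : 2 ≤ R) (hP : R + q + 1 ≤ P) (w : ℂ)
    (hw : ‖w‖ < R) : ∃ K : ℝ, 0 ≤ K ∧ ∀ n : ℕ, 3 ≤ n →
      ‖faulhaberError P w n - zetaFactor w‖ ≤ K / ((n : ℝ) + 1) ^ q := by
  obtain ⟨K, hK0, hK⟩ := exists_norm_faulhaberError_succ_sub_le R q P hP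
  have hs := summable_one_div_succ_pow 0 0
  refine ⟨K * ∑' n : ℕ, 1 / (((n + 0 : ℕ) : ℝ) + 1) ^ (0 + 2),
    mul_nonneg hK0 (tsum_nonneg fun n => by positivity), fun n hn => ?_⟩
  have hlim := ((tendsto_faulhaberError R P hR (by omega) w hw).const_sub
    (faulhaberError P w n)).norm
  refine le_of_tendsto hlim ?_
  filter_upwards [eventually_ge_atTop n] with N hN
  rw [norm_sub_rev, ← Finset.sum_Ico_sub _ hN]
  calc _ ≤ ∑ m ∈ Finset.Ico n N,
        K / ((n : ℝ) + 1) ^ q * (1 / (((m + 0 : ℕ) : ℝ) + 1) ^ (0 + 2)) := by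
        refine norm_sum_le_of_le _ fun m hm => ?_
        rw [Finset.mem_Ico] at hm
        refine (hK w hw.le m (by omega)).trans ?_
        have : (n : ℝ) ≤ m := by exact_mod_cast hm.1
        rw [div_mul_div_comm, mul_one, add_zero, zero_add, pow_add]
        gcongr
    _ ≤ K / ((n : ℝ) + 1) ^ q * ∑' n : ℕ, 1 / (((n + 0 : ℕ) : ℝ) + 1) ^ (0 + 2) := by
        rw [← Finset.mul_sum]
        exact mul_le_mul_of_nonneg_left (hs.sum_le_tsum _ fun n _ => by positivity) (by positivity)
    _ = _ := by ring

theorem faulhaber_asymptotic (α : ℂ) (hα : α ≠ -1) (p : ℕ) :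
    (fun n : ℕ => (∑ k ∈ Finset.Icc 1 n, (k : ℂ) ^ α) - riemannZeta (-α) -
        ∑ k ∈ Finset.range (p + 1), faulhaberTerm α n k)
      =O[atTop] fun n : ℕ => faulhaberU n ^ ((α + 1) / 2 - (p : ℂ) - 1) := by
  have hα' : α + 1 ≠ 0 := fun h => hα (eq_neg_of_add_eq_zero_left h)
  obtain ⟨w, rfl⟩ : ∃ w, α = 2 * w - 1 := ⟨(α + 1) / 2, by ring⟩
  have hw0 : w ≠ 0 := by rintro rfl; simp at hα
  have hw : (2 * w - 1 + 1) / 2 = w := by ring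
  -- Since `u ≤ (n + 1)²`, this makes `(n + 1)^(-q)` at most the target size `|u^(w - p - 1)|`. The
  -- truncation order `P` may exceed `p + 1`; the extra terms are themselves of the target order.
  obtain ⟨q, hq⟩ := exists_nat_ge (2 * |(w - (p : ℂ) - 1).re|)
  obtain ⟨R, hR⟩ := exists_nat_ge (‖w‖ + 2)
  have hR2 : 2 ≤ R := by
    have : (2 : ℝ) ≤ R := by linarith [norm_nonneg w]
    exact_mod_cast this
  obtain ⟨P, hP, hpP⟩ : ∃ P, R + q + 1 ≤ P ∧ p + 1 ≤ P :=
    ⟨max (R + q + 1) (p + 1), le_max_left _ _, le_max_right _ _⟩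
  obtain ⟨K, hK0, hK⟩ := exists_norm_faulhaberError_sub_le R q P hR2 hP w (by linarith)
  have hfun (n : ℕ) : (∑ k ∈ Finset.Icc 1 n, (k : ℂ) ^ (2 * w - 1)) - riemannZeta (-(2 * w - 1)) -
        ∑ k ∈ Finset.range (p + 1), faulhaberTerm (2 * w - 1) n k =
      1 / (2 * w) * ((faulhaberError P w n - zetaFactor w) +
        ∑ k ∈ Finset.Ico (p + 1) P, faulhaberCoeff k w * faulhaberU n ^ (w - k)) := by
    have h1 : ∑ k ∈ Finset.range (p + 1), faulhaberTerm (2 * w - 1) n k =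
        1 / (2 * w) * ∑ k ∈ Finset.range (p + 1),
          faulhaberCoeff k w * faulhaberU n ^ (w - k) := by
      simp only [faulhaberTerm, hw, ← Finset.mul_sum]
      rw [sub_add_cancel]
    rw [h1, zetaFactor_of_ne_zero hw0, faulhaberError, faulhaberPartial,
      ← Finset.sum_range_add_sum_Ico _ hpP, neg_sub]
    field_simp
    ring
  simp only [hfun, hw]
  refine IsBigO.const_mul_left (IsBigO.add ?_ (IsBigO.fun_sum fun k hk => ?_)) _
  · refine IsBigO.of_bound K ?_
    filter_upwards [eventually_ge_atTop 3] with n hn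
    have hn1 : (1 : ℝ) ≤ n := by exact_mod_cast (by omega : 1 ≤ n)
    refine (hK n hn).trans ?_
    rw [norm_faulhaberU_cpow (by omega), div_eq_mul_inv]
    refine mul_le_mul_of_nonneg_left ?_ hK0
    have hu1 : 1 ≤ (n : ℝ) * (n + 1) := by nlinarith
    have hu2 : (n : ℝ) * (n + 1) ≤ ((n : ℝ) + 1) ^ (2 : ℝ) := by
      rw [Real.rpow_two]; nlinarith
    set e := (w - (p : ℂ) - 1).re
    calc (((n : ℝ) + 1) ^ q)⁻¹ = ((n : ℝ) + 1) ^ (-(q : ℝ)) := by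
          rw [Real.rpow_neg (by positivity), Real.rpow_natCast]
      _ ≤ ((n : ℝ) + 1) ^ (2 * -|e|) :=
          Real.rpow_le_rpow_of_exponent_le (by linarith) (by linarith)
      _ = (((n : ℝ) + 1) ^ (2 : ℝ)) ^ (-|e|) := Real.rpow_mul (by positivity) _ _
      _ ≤ ((n : ℝ) * (n + 1)) ^ (-|e|) :=
          Real.rpow_le_rpow_of_nonpos (by linarith) hu2 (by simp)
      _ ≤ ((n : ℝ) * (n + 1)) ^ e := Real.rpow_le_rpow_of_exponent_le hu1 (neg_abs_le e)
  · refine IsBigO.const_mul_left (IsBigO.of_bound 1 ?_) _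
    filter_upwards [eventually_ge_atTop 1] with n hn
    have hn1 : (1 : ℝ) ≤ n := by exact_mod_cast hn
    rw [norm_faulhaberU_cpow (by omega), norm_faulhaberU_cpow (by omega), one_mul]
    refine Real.rpow_le_rpow_of_exponent_le (by nlinarith) ?_
    have : ((p : ℝ) + 1) ≤ k := by exact_mod_cast (Finset.mem_Ico.1 hk).1
    simp only [Complex.sub_re, Complex.natCast_re, Complex.one_re]
    linarith

end Continuation

theorem mainTheorem6 :
    -- the coefficients are polynomials in `w`, given by the explicit formula
    (∀ k : ℕ, (∃ p : Polynomial ℚ, faulhaberRat k = algebraMap (Polynomial ℚ) (RatFunc ℚ) p) ∧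
      faulhaberRat k = faulhaberExplicit k) ∧
    ∀ α : ℂ, α ≠ -1 →
      -- the asymptotic series
      (∀ p : ℕ,
        (fun n : ℕ => (∑ k ∈ Finset.Icc 1 n, (k : ℂ) ^ α) - riemannZeta (-α) -
            ∑ k ∈ Finset.range (p + 1), faulhaberTerm α n k)
          =O[atTop] fun n : ℕ => faulhaberU n ^ ((α + 1) / 2 - (p : ℂ) - 1)) ∧
      -- the series is finite for positive odd `α`
      ((∃ m : ℕ, α = 2 * (m : ℂ) + 1) →
        {k : ℕ | faulhaberCoeff k ((α + 1) / 2) ≠ 0}.Finite) ∧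
      -- the series converges for all large `n` iff `α` is a nonnegative integer
      ((∀ᶠ n : ℕ in atTop, ∃ s : ℂ,
          Tendsto (fun K : ℕ => ∑ k ∈ Finset.range K, faulhaberTerm α n k) atTop (𝓝 s)) ↔
        ∃ m : ℕ, α = (m : ℂ)) := by
  refine ⟨fun k => ⟨⟨faulhaberPoly k, faulhaberRat_eq k⟩, ?_⟩, fun α hα => ⟨?_, ?_, ?_⟩⟩
  · rw [faulhaberRat_eq, faulhaberExplicit_eq]
  · exact faulhaber_asymptotic α hα
  · exact faulhaberCoeff_finite_support_of_odd α
  · exact faulhaberSeries_converges_iff α hα
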